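/- Let $\mathrm{Id}(L)$, $\mathrm{Filt}(L)$, $\mathrm{Con}(L)$ be the sets of (nonempty, possibly improper) ideals, of (nonempty, possibly improper) filters and of congruences of a lattice $L$. A *pseudo-Kleene algebra* is a bounded lattice with an order-reversing unary operation $'$ such that $a''=a$ and $a\wedge a'\le b\vee b'$ for all $a,b$. An *antiortholattice* is a pseudo-Kleene algebra with a further order-reversing unary operation $\sim$ such that, for all $a,b$: $a\wedge a^{\sim}=0$; $a\le a^{\sim\sim}=a^{\sim\prime}$; $(a\wedge a')^{\sim}=a^{\sim}\vee a'^{\sim}$; if $a\le b$ and $a'\wedge b=0$, then $a=b$; and if $a'$ is a lattice complement of $a$, then $a\in\{0,1\}$. Denote by $\mathrm{Con}_{\mathbb I}(A)$ the set of lattice congruences of $A$ that preserve $'$, by $\mathrm{Con}_{\mathbb{BZ}}(A)$ the set of those that preserve both $'$ and $\sim$, by $\mathrm{Con}_{01}(A)$ the set of lattice congruences of $A$ for which the classes of $0$ and of $1$ are singletons, and by $\nabla_A$ the full congruence $A\times A$. **Corollary 4.11.** Assume the Generalized Continuum Hypothesis. Let $\nu$ be an infinite cardinal, let $\varphi,\iota$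 be cardinals with $\nu\le\varphi\le 2^\nu$ and $\nu\le\iota\le 2^\nu$, and let $\kappa$ be a cardinal with $2\le\kappa\le 2^\nu$. 1. There is a bounded lattice $L$ with $|L|=\nu$, $|\mathrm{Filt}(L)|=\varphi$, $|\mathrm{Id}(L)|=\iota$ and $|\mathrm{Con}(L)|=\kappa$. 2. There is a pseudo-Kleene algebra $A$ with $|A|=\nu$, $|\mathrm{Id}(A)|=\iota$ and $|\mathrm{Con}_{\mathbb I}(A)|=\kappa$ such that, if $\kappa<2^\nu$, then moreover $\mathrm{Con}_{\mathbb I}(A)=\mathrm{Con}(A)$. 3. There is an antiortholattice $A$ with $|A|=\nu$, $|\mathrm{Id}(A)|=\iota$ and $|\mathrm{Con}_{\mathbb{BZ}}(A)|=\kappa$ such that, if $\kappa<2^\nu$, then moreover $\mathrm{Con}_{\mathbb{BZ}}(A)\setminus\{\nabla_A\}=\mathrm{Con}_{01}(A)$. Assuming only the Continuum Hypothesis, statements 1, 2 and 3 hold for $\nu=\aleph_0$. -/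

import Mathlib

open Cardinal

universe u

/-- Involution lattices: lattices with an order-reversing unary operation `′` such that `a′′ = a`. -/
class InvolutionLattice (A : Type u) extends Lattice A where
  /-- the involution -/
  kc : A → A
  kc_antitone : ∀ a b : A, a ≤ b → kc b ≤ kc a
  kc_kc : ∀ a : A, kc (kc a) = a

postfix:max "′" => InvolutionLattice.kc

/-- Bounded involution lattices. -/
class BoundedInvolutionLattice (A : Type u) extends InvolutionLattice A, BoundedOrder A

/-- Pseudo-Kleene algebras. -/
class PseudoKleeneAlgebra (A : Type u) extends BoundedInvolutionLattice A where
  kleene : ∀ a b : A, a ⊓ a′ ≤ b ⊔ b′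

/-- Brouwer-Zadeh lattices; `bc` is the Brouwer complement. -/
class BZLattice (A : Type u) extends PseudoKleeneAlgebra A where
  /-- the Brouwer complement -/
  bc : A → A
  bc_antitone : ∀ a b : A, a ≤ b → bc b ≤ bc a
  inf_bc : ∀ a : A, a ⊓ bc a = ⊥
  le_bc_bc : ∀ a : A, a ≤ bc (bc a)
  bc_bc : ∀ a : A, bc (bc a) = (bc a)′

postfix:max "∼" => BZLattice.bc

/-- `PBZ*`-lattices: paraorthomodular BZ-lattices with the condition
`(a ⊓ a′)∼ = a∼ ⊔ a′∼`. -/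
class PBZStarLattice (A : Type u) extends BZLattice A where
  paraorthomodular : ∀ a b : A, a ≤ b → a′ ⊓ b = ⊥ → a = b
  star : ∀ a : A, (a ⊓ a′)∼ = a∼ ⊔ a′∼

/-- Antiortholattices: `PBZ*`-lattices in which `⊥` and `⊤` are the only elements whose Kleene
complements are bounded lattice complements. -/
class Antiortholattice (A : Type u) extends PBZStarLattice A where
  eq_bot_or_eq_top : ∀ a : A, IsCompl a a′ → a = ⊥ ∨ a = ⊤

/-- The congruences of an involution lattice (with or without bounds), as a set of congruences of
its lattice reduct. -/
def conI (A : Type u) [InvolutionLattice A] : Set (LatticeCon A) :=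
  {θ | ∀ a b : A, θ.r a b → θ.r a′ b′}

/-- The congruences of a BZ-lattice (in particular of an antiortholattice), as a set of congruences
of its lattice reduct. -/
def conBZ (A : Type u) [BZLattice A] : Set (LatticeCon A) :=
  {θ | (∀ a b : A, θ.r a b → θ.r a′ b′) ∧ ∀ a b : A, θ.r a b → θ.r a∼ b∼}

/-- The lattice congruences of a bounded lattice for which the classes of `⊥` and of `⊤` are
singletons. -/
def con01 (A : Type u) [Lattice A] [BoundedOrder A] : Set (LatticeCon A) :=
  {θ | (∀ a : A, θ.r ⊥ a → a = ⊥) ∧ ∀ a : A, θ.r ⊤ a → a = ⊤}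

/-- A congruence is proper if it is not the full relation. -/
def IsProperCon {A : Type u} [Lattice A] (θ : LatticeCon A) : Prop :=
  ¬ ∀ a b : A, θ.r a b

/-- The generalized continuum hypothesis. -/
def GCH : Prop := ∀ ν : Cardinal.{u}, ℵ₀ ≤ ν → (2 : Cardinal.{u}) ^ ν = Order.succ ν

/-- The continuum hypothesis. -/
def CH : Prop := (2 : Cardinal.{u}) ^ (ℵ₀ : Cardinal.{u}) = ℵ₁

/-- Bounded lattices with `ν` elements, with any numbers `φ` of filters and `ι` of ideals (between
the numbers `ν` of elements and `2 ^ ν` of subsets), can have any number `κ` of congruences between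
`2` and `2 ^ ν`. -/
def LatticeRealization (ν : Cardinal.{u}) : Prop :=
  ∀ φ ι κ : Cardinal.{u}, ν ≤ φ → φ ≤ 2 ^ ν → ν ≤ ι → ι ≤ 2 ^ ν → 2 ≤ κ → κ ≤ 2 ^ ν →
    ∃ (L : Type u) (_ : Lattice L) (_ : BoundedOrder L),
      #L = ν ∧ #(Order.PFilter L) = φ ∧ #(Order.Ideal L) = ι ∧ #(LatticeCon L) = κ

/-- Pseudo-Kleene algebras with `ν` elements, with any number `ι` of ideals, can have any number `κ`
of congruences between `2` and `2 ^ ν` and, if `κ < 2 ^ ν`, simultaneously have all the congruences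
of their lattice reducts as congruences. -/
def PseudoKleeneRealization (ν : Cardinal.{u}) : Prop :=
  ∀ ι κ : Cardinal.{u}, ν ≤ ι → ι ≤ 2 ^ ν → 2 ≤ κ → κ ≤ 2 ^ ν →
    ∃ (A : Type u) (_ : PseudoKleeneAlgebra A),
      #A = ν ∧ #(Order.Ideal A) = ι ∧ #(conI A) = κ ∧ (κ < 2 ^ ν → conI A = Set.univ)

/-- Antiortholattices with `ν` elements, with any number `ι` of ideals, can have any number `κ` of
congruences between `2` and `2 ^ ν` and, if `κ < 2 ^ ν`, simultaneously have as proper congruences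
exactly the lattice congruences with singleton classes of `⊥` and `⊤`. -/
def AntiortholatticeRealization (ν : Cardinal.{u}) : Prop :=
  ∀ ι κ : Cardinal.{u}, ν ≤ ι → ι ≤ 2 ^ ν → 2 ≤ κ → κ ≤ 2 ^ ν →
    ∃ (A : Type u) (_ : Antiortholattice A),
      #A = ν ∧ #(Order.Ideal A) = ι ∧ #(conBZ A) = κ ∧
        (κ < 2 ^ ν → {θ ∈ conBZ A | IsProperCon θ} = con01 A)

/-! The hypothesis `2 ^ ν = Order.succ ν` leaves only the values `ν` and `2 ^ ν` for the numbers of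
ideals and filters, and only `κ ≤ ν` or `κ = 2 ^ ν` for congruences.

Ideals and filters are controlled by a congruence-simple lattice `M` of size `ν`: a base with the
right ideals, in horizontal sum with `ν` atoms. The atoms force simplicity (`HSum.isSimple`) at the
cost of at most `ν` ideals and `ν` filters. Boolean bases give ortholattices, where the two numbers
agree; finite sets with a top added give many ideals and few filters.

Congruences are controlled by nesting copies of `M` along a well-order `W`. A nontrivial congruence
collapses everything from some level inwards (`Nest.exists_eq_levelCon`), so there are `#W + 1` of
them, while the ideal count stays that of `M` (`Nest.mk_ideal_eq`). For `κ = 2 ^ ν`, the product of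
`M` with a nest of two-element chains has a congruence for each subset of `W`
(`Nest.prodChainCon_injective`). Both constructions carry a Kleene involution when `M` is an
ortholattice.

For antiortholattices, new bounds are added to a pseudo-Kleene algebra, with the trivial Brouwer
complement. Its proper congruences are then the old ones extended by singleton bounds, and the full
congruence adds one. This reaches `κ ≥ 3`; for `κ = 2` a simple ortholattice is glued below its dual
(`dualSum.con01_eq`). -/

namespace Order.Ideal

/-! ### Counting ideals -/

section Preorder

variable {P Q : Type u} [Preorder P] [Preorder Q]

/-- The ideal generated by the image of an ideal under a monotone map. -/
def mapMono (f : P → Q) (hf : Monotone f) (I : Ideal P) : Ideal Q where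
  carrier := {z | ∃ x ∈ I, z ≤ f x}
  lower' := fun _ _ h ⟨x, hx, hz⟩ => ⟨x, hx, h.trans hz⟩
  nonempty' := I.nonempty.imp' f fun x hx => ⟨x, hx, le_rfl⟩
  directed' := by
    rintro a ⟨x, hx, ha⟩ b ⟨y, hy, hb⟩
    obtain ⟨z, hz, hxz, hyz⟩ := I.directed x hx y hy
    exact ⟨f z, ⟨z, hz, le_rfl⟩, ha.trans (hf hxz), hb.trans (hf hyz)⟩

/-- Since `f` reflects the order, an ideal is the preimage of the ideal generated by its image. -/
theorem mk_le_of_orderEmbedding (f : P ↪o Q) : #(Ideal P) ≤ #(Ideal Q) := by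
  refine mk_le_of_injective (f := mapMono f f.monotone) fun I J h => ?_
  have key : ∀ (K : Ideal P) (x : P), f x ∈ mapMono f f.monotone K ↔ x ∈ K := fun K x =>
    ⟨fun ⟨y, hy, hxy⟩ => K.lower (f.le_iff_le.1 hxy) hy, fun hx => ⟨x, hx, le_rfl⟩⟩
  ext x
  exact (key I x).symm.trans ((iff_of_eq (congrArg (f x ∈ ·) h)).trans (key J x))

theorem mk_congr (e : P ≃o Q) : #(Ideal P) = #(Ideal Q) :=
  le_antisymm (mk_le_of_orderEmbedding e.toOrderEmbedding)
    (mk_le_of_orderEmbedding e.symm.toOrderEmbedding)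

variable (P) in
theorem mk_le_two_power : #(Ideal P) ≤ 2 ^ #P := by
  rw [← mk_set]
  exact mk_le_of_injective (f := fun I : Ideal P => (I : Set P)) SetLike.coe_injective

variable (P) in
theorem mk_pfilter : #(PFilter P) = #(Ideal Pᵒᵈ) :=
  Cardinal.mk_congr ⟨PFilter.dual, PFilter.mk, fun _ => rfl, fun _ => rfl⟩

end Preorder

theorem mk_type_le (P : Type u) [PartialOrder P] : #P ≤ #(Ideal P) :=
  mk_le_of_injective (f := fun x : P => principal x) fun _ _ h =>
    le_antisymm (principal_le_iff.1 h.le) (principal_le_iff.1 h.ge)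

/-- A maximal element of a directed set is its greatest element, so every ideal is principal. -/
theorem mk_le_of_wellFoundedGT (P : Type u) [PartialOrder P] [WellFoundedGT P] :
    #(Ideal P) ≤ #P := by
  refine mk_le_of_surjective (f := fun x : P => principal x) fun I => ?_
  obtain ⟨m, hm, hmax⟩ := WellFounded.has_min (wellFounded_gt (α := P)) (I : Set P) I.nonempty
  refine ⟨m, le_antisymm (principal_le_iff.2 hm) fun x hx => ?_⟩
  obtain ⟨z, hz, hmz, hxz⟩ := I.directed m hm x hx
  rcases hmz.eq_or_lt with rfl | h
  · exact hxz
  · exact absurd h (hmax z hz)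

/-- An ideal of a well-order is either everything (`none`) or the initial segment below the least
element outside it. -/
theorem mk_le_of_wellFoundedLT (P : Type u) [LinearOrder P] [WellFoundedLT P] :
    #(Ideal P) ≤ #P + 1 := by
  classical
  rw [← mk_option]
  have hex : ∀ I : Ideal P, ∃ o : Option P, ∀ x, x ∈ I ↔ ∀ m ∈ o, x < m := by
    intro I
    by_cases h : ∀ x, x ∈ I
    · exact ⟨none, by simpa using h⟩
    · push Not at h
      obtain ⟨m, hm, hmin⟩ := WellFounded.has_min (wellFounded_lt (α := P)) {x | x ∉ I} h
      refine ⟨some m, fun x => ?_⟩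
      simp only [Option.mem_def, Option.some.injEq, forall_eq']
      refine ⟨fun hx => lt_of_not_ge fun hmx => hm (I.lower hmx hx), fun hx => ?_⟩
      by_contra hxI
      exact hmin x hxI hx
  choose F hF using hex
  refine mk_le_of_injective (f := F) fun I J h => ?_
  ext x
  exact (hF I x).trans (h ▸ (hF J x).symm)

/-- The common tool for bounding numbers of ideals: if the part of `D` in the range of `f` is
cofinal, then `D` is generated by its preimage, which `hsup` makes directed. -/
theorem exists_mapMono_eq {P Q : Type u} [SemilatticeSup P] [SemilatticeSup Q] (f : P → Q)
    (hf : Monotone f) (hsup : ∀ x y, f (x ⊔ y) ≤ f x ⊔ f y) (D : Ideal Q)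
    (h : ∀ z ∈ D, ∃ x, f x ∈ D ∧ z ≤ f x) : ∃ E : Ideal P, mapMono f hf E = D := by
  refine ⟨⟨⟨{x | f x ∈ D}, fun x y hyx hx => D.lower (hf hyx) hx⟩, ?_, ?_⟩, ?_⟩
  · obtain ⟨z, hz⟩ := D.nonempty
    obtain ⟨x, hx, -⟩ := h z hz
    exact ⟨x, hx⟩
  · exact fun x hx y hy => ⟨x ⊔ y, D.lower (hsup x y) (sup_mem hx hy), le_sup_left, le_sup_right⟩
  · ext z
    exact ⟨fun ⟨x, hx, hz⟩ => D.lower hz hx, fun hz => h z hz⟩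

/-- Ideals of a product of bounded lattices are products of ideals. -/
theorem mk_prod_le (P Q : Type u) [SemilatticeSup P] [OrderBot P] [SemilatticeSup Q]
    [OrderBot Q] : #(Ideal (P × Q)) ≤ #(Ideal P) * #(Ideal Q) := by
  rw [mul_def]
  have hex : ∀ D : Ideal (P × Q), ∃ E : Ideal P × Ideal Q,
      ∀ x y, (x, y) ∈ D ↔ x ∈ E.1 ∧ y ∈ E.2 := by
    intro D
    have hb : (⊥ : P × Q) ∈ D := D.bot_mem
    refine ⟨(⟨⟨{x | (x, ⊥) ∈ D}, fun x y h hx => D.lower (Prod.mk_le_mk.2 ⟨h, le_rfl⟩) hx⟩,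
        ⟨⊥, hb⟩, fun x hx y hy => ⟨x ⊔ y, ?_, le_sup_left, le_sup_right⟩⟩,
      ⟨⟨{x | (⊥, x) ∈ D}, fun x y h hx => D.lower (Prod.mk_le_mk.2 ⟨le_rfl, h⟩) hx⟩,
        ⟨⊥, hb⟩, fun x hx y hy => ⟨x ⊔ y, ?_, le_sup_left, le_sup_right⟩⟩), fun x y => ?_⟩
    · have := sup_mem hx hy
      simpa using this
    · have := sup_mem hx hy
      simpa using this
    · refine ⟨fun h => ⟨D.lower (Prod.mk_le_mk.2 ⟨le_rfl, bot_le⟩) h,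
        D.lower (Prod.mk_le_mk.2 ⟨bot_le, le_rfl⟩) h⟩, fun h => ?_⟩
      -- `(x, y)` is the join of `(x, ⊥)` and `(⊥, y)`.
      have := sup_mem (s := D) h.1 h.2
      simpa using this
  choose F hF using hex
  refine mk_le_of_injective (f := F) fun I J h => ?_
  ext ⟨x, y⟩
  exact (hF I x y).trans (h ▸ (hF J x y).symm)

end Order.Ideal

/-! ### Generalities on lattice congruences -/

namespace LatticeCon

variable {A B : Type u} [Lattice A] [Lattice B]

theorem ext_r {θ ψ : LatticeCon A} (h : ∀ a b, θ.r a b ↔ ψ.r a b) : θ = ψ := by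
  obtain ⟨s, _, _⟩ := θ
  obtain ⟨t, _, _⟩ := ψ
  obtain rfl : s = t := Setoid.ext h
  rfl

/-- The preimage of a congruence under a map that preserves both operations. -/
def comap (f : A → B) (hi : ∀ x y, f (x ⊓ y) = f x ⊓ f y) (hs : ∀ x y, f (x ⊔ y) = f x ⊔ f y)
    (θ : LatticeCon B) : LatticeCon A where
  toSetoid := Setoid.comap f θ.toSetoid
  inf := fun {w x y z} h k => by
    change θ.r (f _) (f _)
    rw [hi, hi]; exact θ.inf h k
  sup := fun {w x y z} h k => by
    change θ.r (f _) (f _)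
    rw [hs, hs]; exact θ.sup h k

/-- The congruences of the dual lattice. -/
def dualEquiv : LatticeCon A ≃ LatticeCon Aᵒᵈ where
  toFun θ := ⟨⟨fun x y => θ.r x.ofDual y.ofDual, fun _ => θ.refl _, θ.symm, θ.trans⟩,
    θ.sup, θ.inf⟩
  invFun θ := ⟨⟨fun x y => θ.r (.toDual x) (.toDual y), fun _ => θ.refl _, θ.symm, θ.trans⟩,
    θ.sup, θ.inf⟩
  left_inv _ := rfl
  right_inv _ := rfl

theorem mk_le_two_power (A : Type u) [Lattice A] : #(LatticeCon A) ≤ 2 ^ (#A * #A) := by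
  rw [mul_def, ← mk_set]
  refine mk_le_of_injective (f := fun θ : LatticeCon A => {p : A × A | θ.r p.1 p.2}) ?_
  intro θ ψ h
  exact ext_r fun a b => Set.ext_iff.1 h (a, b)

theorem r_convex (θ : LatticeCon A) {a b c d : A} (h : θ.r a d) (hab : a ≤ b) (hbc : b ≤ c)
    (hcd : c ≤ d) : θ.r b c := by
  have key : ∀ x, a ≤ x → x ≤ d → θ.r a x := fun x h1 h2 => by
    have := θ.inf h (θ.refl x)
    rwa [inf_eq_left.2 h1, inf_eq_right.2 h2] at this
  exact θ.trans (θ.symm (key b hab (hbc.trans hcd))) (key c (hab.trans hbc) hcd)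

/-- The full congruence. -/
def full (A : Type u) [Lattice A] : LatticeCon A := ⟨⊤, fun _ _ => trivial, fun _ _ => trivial⟩

/-- The identity congruence. -/
def eqCon (A : Type u) [Lattice A] : LatticeCon A where
  toSetoid := ⊥
  inf := fun {w x y z} (h : w = x) (k : y = z) => by subst h k; exact rfl
  sup := fun {w x y z} (h : w = x) (k : y = z) => by subst h k; exact rfl

theorem eqCon_r {a b : A} : (eqCon A).r a b ↔ a = b := Iff.rfl

/-- A lattice is congruence-simple if every congruence is the identity or full. -/
def IsSimple (A : Type u) [Lattice A] : Prop :=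
  ∀ θ : LatticeCon A, (∀ a b, θ.r a b → a = b) ∨ ∀ a b, θ.r a b

theorem full_of_bot_top [BoundedOrder A] (θ : LatticeCon A) (h : θ.r ⊥ ⊤) (a b : A) : θ.r a b :=
  have key : ∀ x, θ.r ⊥ x := fun _ => θ.r_convex h le_rfl bot_le le_top
  θ.trans (θ.symm (key a)) (key b)

end LatticeCon

/-! ### Horizontal sums and simplicity -/

/-- The horizontal sum of a bounded lattice `B` with the bounded lattice whose set of atoms (and of
coatoms) is the antichain `X`. -/
inductive HSum (B X : Type u) : Type u
  | base : B → HSum B X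
  | atom : X → HSum B X

namespace HSum

theorem mk_eq (B X : Type u) : #(HSum B X) = #B + #X := by
  rw [add_def]
  exact mk_congr
    ⟨fun | base a => .inl a | atom x => .inr x, fun | .inl a => base a | .inr x => atom x,
      by rintro (a | a) <;> rfl, by rintro (a | a) <;> rfl⟩

section Order

variable {B X : Type u} [Lattice B] [BoundedOrder B]

/-- The order of the horizontal sum. -/
protected def le : HSum B X → HSum B X → Prop
  | base a, base b => a ≤ b
  | base a, atom _ => a = ⊥
  | atom _, base b => b = ⊤
  | atom x, atom y => x = y

open Classical in
/-- The join of the horizontal sum. -/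
protected noncomputable def sup : HSum B X → HSum B X → HSum B X
  | base a, base b => base (a ⊔ b)
  | base a, atom x => if a = ⊥ then atom x else base ⊤
  | atom x, base a => if a = ⊥ then atom x else base ⊤
  | atom x, atom y => if x = y then atom x else base ⊤

open Classical in
/-- The meet of the horizontal sum. -/
protected noncomputable def inf : HSum B X → HSum B X → HSum B X
  | base a, base b => base (a ⊓ b)
  | base a, atom x => if a = ⊤ then atom x else base ⊥
  | atom x, base a => if a = ⊤ then atom x else base ⊥
  | atom x, atom y => if x = y then atom x else base ⊥

variable [Nontrivial B]

noncomputable instance : Lattice (HSum B X) where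
  le := HSum.le
  le_refl := by rintro (a | a) <;> simp [HSum.le]
  le_trans := by
    rintro (a | a) (b | b) (c | c) <;> simp only [HSum.le] <;> intro h k
    · exact h.trans k
    · subst k; exact le_bot_iff.1 h
    · subst h k; exact bot_le
    · exact h
    · subst h; exact top_le_iff.1 k
    · subst h; exact absurd k top_ne_bot
    · exact k
    · exact h.trans k
  le_antisymm := by
    rintro (a | a) (b | b) <;> simp only [HSum.le] <;> intro h k
    · rw [le_antisymm h k]
    · exact absurd (k.symm.trans h) top_ne_bot
    · exact absurd (h.symm.trans k) top_ne_bot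
    · rw [h]
  sup := HSum.sup
  inf := HSum.inf
  le_sup_left := by
    rintro (a | a) (b | b) <;> simp only [HSum.sup, HSum.le, le_sup_left] <;>
      split_ifs <;> simp_all
  le_sup_right := by
    rintro (a | a) (b | b) <;> simp only [HSum.sup, HSum.le, le_sup_right] <;>
      split_ifs <;> simp_all
  sup_le := by
    rintro (a | a) (b | b) (c | c) <;> simp only [HSum.sup, HSum.le, sup_le_iff] <;> intro h k <;>
      first
      | exact ⟨h, k⟩
      | (split_ifs <;> simp_all)
      | simp_all
  inf_le_left := by
    rintro (a | a) (b | b) <;> simp only [HSum.inf, HSum.le, inf_le_left] <;>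
      split_ifs <;> simp_all
  inf_le_right := by
    rintro (a | a) (b | b) <;> simp only [HSum.inf, HSum.le, inf_le_right] <;>
      split_ifs <;> simp_all
  le_inf := by
    rintro (a | a) (b | b) (c | c) <;> simp only [HSum.inf, HSum.le, le_inf_iff] <;> intro h k <;>
      first
      | exact ⟨h, k⟩
      | (split_ifs <;> simp_all)
      | simp_all

noncomputable instance : BoundedOrder (HSum B X) where
  top := base ⊤
  bot := base ⊥
  le_top := by
    rintro (a | a)
    · exact le_top (a := a)
    · exact rfl
  bot_le := by
    rintro (a | a)
    · exact bot_le (a := a)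
    · exact rfl

theorem base_sup_atom {a : B} {x : X} (h : a ≠ ⊥) : (base a : HSum B X) ⊔ atom x = ⊤ := if_neg h
theorem base_inf_atom {a : B} {x : X} (h : a ≠ ⊤) : (base a : HSum B X) ⊓ atom x = ⊥ := if_neg h
theorem atom_sup_atom {x y : X} (h : x ≠ y) : (atom x : HSum B X) ⊔ atom y = ⊤ := if_neg h
theorem atom_inf_atom {x y : X} (h : x ≠ y) : (atom x : HSum B X) ⊓ atom y = ⊥ := if_neg h

instance : Nontrivial (HSum B X) := ⟨base ⊥, base ⊤, by simp⟩

theorem atom_ne_bot (x : X) : (atom x : HSum B X) ≠ ⊥ := nofun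
theorem atom_ne_top (x : X) : (atom x : HSum B X) ≠ ⊤ := nofun

/-- The inclusion of the base. -/
def baseEmbedding : B ↪o HSum B X where
  toFun := base
  inj' := fun _ _ h => by injection h
  map_rel_iff' := Iff.rfl

/-- The horizontal sum commutes with duality. -/
def dualIso : (HSum B X)ᵒᵈ ≃o HSum Bᵒᵈ X where
  toFun
    | base a => base a
    | atom x => atom x
  invFun
    | base a => base a
    | atom x => atom x
  left_inv := by rintro (a | a) <;> rfl
  right_inv := by rintro (a | a) <;> rfl
  map_rel_iff' := by
    rintro (a | a) (b | b)
    · exact Iff.rfl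
    · exact Iff.rfl
    · exact Iff.rfl
    · exact ⟨Eq.symm, Eq.symm⟩

theorem le_mk_ideal : #(Order.Ideal B) ≤ #(Order.Ideal (HSum B X)) :=
  Order.Ideal.mk_le_of_orderEmbedding baseEmbedding

/-- An atom joined with anything other than itself and `⊥` gives `⊤`, so a proper ideal containing
an atom is principal. Any other ideal is generated by its base elements. -/
theorem mk_ideal_le : #(Order.Ideal (HSum B X)) ≤ #(Order.Ideal B) + #X := by
  have hm : Monotone (base : B → HSum B X) := baseEmbedding.monotone
  rw [add_def]
  refine mk_le_of_surjective (f := Sum.elim (Order.Ideal.mapMono base hm)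
    (fun x => Order.Ideal.principal (atom x))) fun D => ?_
  by_cases h : ∃ x, atom x ∈ D ∧ (⊤ : HSum B X) ∉ D
  · obtain ⟨x, hx, hT⟩ := h
    refine ⟨.inr x, le_antisymm (Order.Ideal.principal_le_iff.2 hx) fun z hz => ?_⟩
    have hs := Order.Ideal.sup_mem hz hx
    rcases z with (a | y)
    · by_cases ha : a = ⊥
      · exact ha
      · rw [base_sup_atom ha] at hs; exact absurd hs hT
    · by_cases hxy : y = x
      · exact hxy
      · rw [atom_sup_atom hxy] at hs; exact absurd hs hT
  · push Not at h
    obtain ⟨E, hE⟩ := Order.Ideal.exists_mapMono_eq base hm (fun _ _ => le_rfl) D (by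
      rintro (a | x) hz
      · exact ⟨a, hz, le_rfl⟩
      · exact ⟨⊤, h x hz, le_top⟩)
    exact ⟨.inl E, hE⟩

end Order

/-- A bounded lattice all of whose nontrivial congruences have a nontrivial class of `⊥` or `⊤`. -/
def BoundsCollapse (B : Type u) [Lattice B] [BoundedOrder B] : Prop :=
  ∀ θ : LatticeCon B, ∀ a b, θ.r a b → a ≠ b → (∃ c ≠ ⊥, θ.r ⊥ c) ∨ ∃ c ≠ ⊤, θ.r c ⊤

/-- Any two distinct atoms are complements, and each atom is a complement of every base element
other than the bounds. Collapsing something with one bound therefore pushes at least two atoms to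
the other bound, and these two collapse the bounds. Having three atoms (`hX`) leaves two besides any
given one; `hB` reduces a collapse inside the base to one at a bound. -/
theorem isSimple {B X : Type u} [Lattice B] [BoundedOrder B] [Nontrivial B]
    (hB : BoundsCollapse B) [Nonempty X] (hX : ∀ x y : X, ∃ z, z ≠ x ∧ z ≠ y) :
    LatticeCon.IsSimple (HSum B X) := by
  intro θ
  by_cases hθ : ∀ a b, θ.r a b → a = b
  · exact .inl hθ
  refine .inr (θ.full_of_bot_top ?_)
  have two : ∀ x : X, ∃ y z, y ≠ x ∧ z ≠ x ∧ y ≠ z := fun x => by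
    obtain ⟨y, hy, -⟩ := hX x x
    obtain ⟨z, hz, hzy⟩ := hX x y
    exact ⟨y, z, hy, hz, hzy.symm⟩
  -- two atoms collapsed with the same bound collapse the bounds
  have up : ∀ y z : X, y ≠ z → θ.r (atom y) ⊤ → θ.r (atom z) ⊤ → θ.r ⊥ ⊤ := fun y z h hy hz => by
    simpa [atom_inf_atom h] using θ.inf hy hz
  have down : ∀ y z : X, y ≠ z → θ.r ⊥ (atom y) → θ.r ⊥ (atom z) → θ.r ⊥ ⊤ :=
    fun y z h hy hz => by simpa [atom_sup_atom h] using θ.sup hy hz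
  have botBase : ∀ c : B, c ≠ ⊥ → θ.r ⊥ (base c) → X → θ.r ⊥ ⊤ := fun c hc h x => by
    obtain ⟨y, z, -, -, hyz⟩ := two x
    have key : ∀ w, θ.r (atom w) ⊤ := fun w => by
      simpa [base_sup_atom hc] using θ.sup h (θ.refl (atom w))
    exact up y z hyz (key y) (key z)
  have topBase : ∀ c : B, c ≠ ⊤ → θ.r (base c) ⊤ → X → θ.r ⊥ ⊤ := fun c hc h x => by
    obtain ⟨y, z, -, -, hyz⟩ := two x
    have key : ∀ w, θ.r ⊥ (atom w) := fun w => by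
      simpa [base_inf_atom hc] using θ.inf h (θ.refl (atom w))
    exact down y z hyz (key y) (key z)
  have botAtom : ∀ x : X, θ.r ⊥ (atom x) → θ.r ⊥ ⊤ := fun x h => by
    obtain ⟨y, z, hy, hz, hyz⟩ := two x
    have key : ∀ w, w ≠ x → θ.r (atom w) ⊤ := fun w hw => by
      simpa [atom_sup_atom hw.symm] using θ.sup h (θ.refl (atom w))
    exact up y z hyz (key y hy) (key z hz)
  have topAtom : ∀ x : X, θ.r (atom x) ⊤ → θ.r ⊥ ⊤ := fun x h => by
    obtain ⟨y, z, hy, hz, hyz⟩ := two x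
    have key : ∀ w, w ≠ x → θ.r ⊥ (atom w) := fun w hw => by
      simpa [atom_inf_atom hw.symm] using θ.inf h (θ.refl (atom w))
    exact down y z hyz (key y hy) (key z hz)
  have baseAtom : ∀ (a : B) (x : X), θ.r (base a) (atom x) → θ.r ⊥ ⊤ := fun a x h => by
    by_cases ha : a = ⊥
    · subst ha; exact botAtom x h
    · exact topAtom x (θ.symm (by simpa [base_sup_atom ha] using θ.sup h (θ.refl (atom x))))
  push Not at hθ
  obtain ⟨a | x, b | y, hab, hne⟩ := hθ
  · obtain ⟨x⟩ := ‹Nonempty X›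
    rcases hB (θ.comap base (fun _ _ => rfl) (fun _ _ => rfl)) a b hab
      (fun h => hne (by rw [h])) with ⟨c, hc, h⟩ | ⟨c, hc, h⟩
    · exact botBase c hc h x
    · exact topBase c hc h x
  · exact baseAtom a y hab
  · exact baseAtom b x (θ.symm hab)
  · have hxy : x ≠ y := fun h => hne (by rw [h])
    exact botAtom y (by simpa [atom_inf_atom hxy] using θ.inf hab (θ.refl (atom y)))

end HSum

/-! ### Nests: order, ideals and congruences -/

/-- The nest of copies of a bounded lattice `M` indexed by `W`: the copy of index `i` lies strictly
between the bounds of the copy of index `j`, and is incomparable with its other elements, whenever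
`j < i`. -/
@[ext]
structure Nest (W M : Type u) : Type u where
  /-- the index of the copy -/
  idx : W
  /-- the element of the copy -/
  val : M

namespace Nest

theorem mk_eq (W M : Type u) : #(Nest W M) = #W * #M := by
  rw [mul_def]
  exact mk_congr ⟨fun z => (z.1, z.2), fun z => ⟨z.1, z.2⟩, fun _ => rfl, fun _ => rfl⟩

section Order

variable {W M : Type u} [LinearOrder W] [Lattice M] [BoundedOrder M]

instance : LE (Nest W M) where
  le p q := (p.idx = q.idx ∧ p.val ≤ q.val) ∨ (p.idx < q.idx ∧ p.val = ⊥) ∨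
    (q.idx < p.idx ∧ q.val = ⊤)

theorem le_def {p q : Nest W M} : p ≤ q ↔ (p.idx = q.idx ∧ p.val ≤ q.val) ∨
    (p.idx < q.idx ∧ p.val = ⊥) ∨ (q.idx < p.idx ∧ q.val = ⊤) := Iff.rfl

theorem mk_le_mk {i : W} {x y : M} : (⟨i, x⟩ : Nest W M) ≤ ⟨i, y⟩ ↔ x ≤ y := by simp [le_def]

theorem bot_le_of_le {i j : W} (h : i ≤ j) (y : M) : (⟨i, ⊥⟩ : Nest W M) ≤ ⟨j, y⟩ := by
  rcases h.eq_or_lt with rfl | h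
  · exact mk_le_mk.2 bot_le
  · exact .inr (.inl ⟨h, rfl⟩)

theorem le_top_of_le {i j : W} (h : i ≤ j) (y : M) : (⟨j, y⟩ : Nest W M) ≤ ⟨i, ⊤⟩ := by
  rcases h.eq_or_lt with rfl | h
  · exact mk_le_mk.2 le_top
  · exact .inr (.inr ⟨h, rfl⟩)

open Classical in
noncomputable instance : Max (Nest W M) where
  max p q :=
    if p.idx = q.idx then ⟨p.idx, p.val ⊔ q.val⟩
    else if p.idx < q.idx then (if p.val = ⊥ then q else ⟨p.idx, ⊤⟩)
    else (if q.val = ⊥ then p else ⟨q.idx, ⊤⟩)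

open Classical in
noncomputable instance : Min (Nest W M) where
  min p q :=
    if p.idx = q.idx then ⟨p.idx, p.val ⊓ q.val⟩
    else if p.idx < q.idx then (if p.val = ⊤ then q else ⟨p.idx, ⊥⟩)
    else (if q.val = ⊤ then p else ⟨q.idx, ⊥⟩)

open Classical in
theorem max_def (p q : Nest W M) : max p q =
    if p.idx = q.idx then ⟨p.idx, p.val ⊔ q.val⟩
    else if p.idx < q.idx then (if p.val = ⊥ then q else ⟨p.idx, ⊤⟩)
    else (if q.val = ⊥ then p else ⟨q.idx, ⊤⟩) := rfl

open Classical in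
theorem min_def (p q : Nest W M) : min p q =
    if p.idx = q.idx then ⟨p.idx, p.val ⊓ q.val⟩
    else if p.idx < q.idx then (if p.val = ⊤ then q else ⟨p.idx, ⊥⟩)
    else (if q.val = ⊤ then p else ⟨q.idx, ⊥⟩) := rfl

theorem sup_eq {i : W} {x y : M} : (⟨i, x⟩ : Nest W M) ⊔ ⟨i, y⟩ = ⟨i, x ⊔ y⟩ := if_pos rfl

theorem inf_eq {i : W} {x y : M} : (⟨i, x⟩ : Nest W M) ⊓ ⟨i, y⟩ = ⟨i, x ⊓ y⟩ := if_pos rfl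

theorem sup_of_lt {i j : W} {x y : M} (h : i < j) (hx : x ≠ ⊥) :
    (⟨i, x⟩ : Nest W M) ⊔ ⟨j, y⟩ = ⟨i, ⊤⟩ := by
  change ite _ _ _ = _
  simp [h.ne, h, hx]

theorem inf_of_lt {i j : W} {x y : M} (h : i < j) (hx : x ≠ ⊤) :
    (⟨i, x⟩ : Nest W M) ⊓ ⟨j, y⟩ = ⟨i, ⊥⟩ := by
  change ite _ _ _ = _
  simp [h.ne, h, hx]

variable [Nontrivial M]

instance : PartialOrder (Nest W M) where
  le_refl p := .inl ⟨rfl, le_rfl⟩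
  le_trans := by
    rintro ⟨i, x⟩ ⟨j, y⟩ ⟨k, z⟩
    simp only [le_def]
    rintro (⟨rfl, h⟩ | ⟨h, rfl⟩ | ⟨h, rfl⟩) (⟨rfl, k'⟩ | ⟨k', hk⟩ | ⟨k', rfl⟩)
    · exact .inl ⟨rfl, h.trans k'⟩
    · exact .inr (.inl ⟨k', le_bot_iff.1 (hk ▸ h)⟩)
    · exact .inr (.inr ⟨k', rfl⟩)
    · exact .inr (.inl ⟨h, rfl⟩)
    · exact .inr (.inl ⟨h.trans k', rfl⟩)
    · rcases lt_trichotomy i k with l | rfl | l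
      · exact .inr (.inl ⟨l, rfl⟩)
      · exact .inl ⟨rfl, bot_le⟩
      · exact .inr (.inr ⟨l, rfl⟩)
    · exact .inr (.inr ⟨h, top_le_iff.1 k'⟩)
    · exact absurd hk top_ne_bot
    · exact .inr (.inr ⟨k'.trans h, rfl⟩)
  le_antisymm := by
    rintro ⟨i, x⟩ ⟨j, y⟩
    simp only [le_def]
    rintro (⟨rfl, h⟩ | ⟨h, rfl⟩ | ⟨h, rfl⟩) (⟨e, k'⟩ | ⟨k', hk⟩ | ⟨k', hk⟩)
    · rw [le_antisymm h k']
    all_goals first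
      | exact absurd k' h.asymm
      | exact absurd h (by simp_all)

noncomputable instance : Lattice (Nest W M) where
  sup := max
  inf := min
  le_sup_left p q := by
    rcases lt_trichotomy p.idx q.idx with h | h | h <;>
      simp only [max_def, le_def] <;> split_ifs <;> simp_all [lt_asymm]
  le_sup_right p q := by
    rcases lt_trichotomy p.idx q.idx with h | h | h <;>
      simp only [max_def, le_def] <;> split_ifs <;> simp_all [lt_asymm]
  sup_le p q r := by
    rcases lt_trichotomy p.idx q.idx with h | h | h <;>
      simp only [max_def, le_def] <;> split_ifs <;> grind [_root_.sup_le]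
  inf_le_left p q := by
    rcases lt_trichotomy p.idx q.idx with h | h | h <;>
      simp only [min_def, le_def] <;> split_ifs <;> simp_all [lt_asymm]
  inf_le_right p q := by
    rcases lt_trichotomy p.idx q.idx with h | h | h <;>
      simp only [min_def, le_def] <;> split_ifs <;> simp_all [lt_asymm]
  le_inf p q r := by
    rcases lt_trichotomy q.idx r.idx with h | h | h <;>
      simp only [min_def, le_def] <;> split_ifs <;> grind [_root_.le_inf]

noncomputable instance [OrderBot W] : BoundedOrder (Nest W M) where
  top := ⟨⊥, ⊤⟩
  bot := ⟨⊥, ⊥⟩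
  le_top z := le_top_of_le bot_le z.val
  bot_le z := bot_le_of_le bot_le z.val

instance [Nonempty W] : Nontrivial (Nest W M) :=
  ⟨⟨Classical.arbitrary W, ⊥⟩, ⟨Classical.arbitrary W, ⊤⟩, by simp⟩

/-- Duality of nests. -/
def dualIso : (Nest W M)ᵒᵈ ≃o Nest W Mᵒᵈ where
  toFun z := ⟨z.ofDual.1, .toDual z.ofDual.2⟩
  invFun z := .toDual ⟨z.1, z.2.ofDual⟩
  left_inv _ := rfl
  right_inv _ := rfl
  map_rel_iff' := or_congr (and_congr eq_comm Iff.rfl) or_comm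

/-- The inclusion of one of the copies. -/
def copyEmbedding (i : W) : M ↪o Nest W M where
  toFun x := ⟨i, x⟩
  inj' _ _ h := by injection h
  map_rel_iff' := mk_le_mk

theorem le_mk_ideal [Nonempty W] : #(Order.Ideal M) ≤ #(Order.Ideal (Nest W M)) :=
  Order.Ideal.mk_le_of_orderEmbedding (copyEmbedding (Classical.arbitrary W))

/-- Take the least index `i` at which the ideal has a non-bottom element. Elements further out are
bottoms, hence below copy `i`; a member further in forces `⟨i, ⊤⟩` into the ideal. So the ideal is
generated inside copy `i`. If no such index exists, the ideal consists of bottoms, which form a copy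
of `W`. -/
theorem mk_ideal_le [WellFoundedLT W] :
    #(Order.Ideal (Nest W M)) ≤ #W * #(Order.Ideal M) + #(Order.Ideal W) := by
  have hb : Monotone fun w : W => (⟨w, ⊥⟩ : Nest W M) := fun _ _ h => bot_le_of_le h ⊥
  rw [mul_def, add_def]
  refine mk_le_of_surjective (f := Sum.elim
    (fun p : W × Order.Ideal M => p.2.mapMono _ (copyEmbedding p.1).monotone)
    (fun E => E.mapMono _ hb)) fun D => ?_
  by_cases h : ∃ i, ∃ x ≠ ⊥, (⟨i, x⟩ : Nest W M) ∈ D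
  · obtain ⟨i, ⟨x, hx, hi⟩, hmin⟩ :=
      WellFounded.has_min (wellFounded_lt (α := W)) {i | ∃ x ≠ ⊥, (⟨i, x⟩ : Nest W M) ∈ D} h
    obtain ⟨E, hE⟩ := Order.Ideal.exists_mapMono_eq _ (copyEmbedding i).monotone
      (fun x y => (sup_eq (x := x) (y := y)).ge) D (by
        rintro ⟨j, y⟩ hz
        rcases lt_trichotomy i j with l | rfl | l
        · refine ⟨⊤, ?_, le_top_of_le l.le y⟩
          change (⟨i, ⊤⟩ : Nest W M) ∈ D
          rw [← sup_of_lt l hx]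
          exact Order.Ideal.sup_mem hi hz
        · exact ⟨y, hz, le_rfl⟩
        · refine ⟨x, hi, ?_⟩
          obtain rfl : y = ⊥ := by
            by_contra hy
            exact hmin j ⟨y, hy, hz⟩ l
          exact bot_le_of_le l.le x)
    exact ⟨.inl (i, E), hE⟩
  · push Not at h
    obtain ⟨E, hE⟩ := Order.Ideal.exists_mapMono_eq _ hb (fun x y => hb.map_sup x y |>.le) D (by
      rintro ⟨j, y⟩ hz
      obtain rfl : y = ⊥ := by
        by_contra hy
        exact h j y hy hz
      exact ⟨j, hz, le_rfl⟩)
    exact ⟨.inr E, hE⟩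

/-- The congruence that collapses all copies of index at least `w`. -/
def levelCon (w : W) : LatticeCon (Nest W M) where
  r p q := p = q ∨ (w ≤ p.idx ∧ w ≤ q.idx)
  iseqv := ⟨fun _ => .inl rfl, by grind, by grind⟩
  inf {p q p' q'} := by
    change _ → _ → (min p p' = min q q' ∨ _ ≤ (min p p').idx ∧ _ ≤ (min q q').idx)
    simp only [min_def]
    grind
  sup {p q p' q'} := by
    change _ → _ → (max p p' = max q q' ∨ _ ≤ (max p p').idx ∧ _ ≤ (max q q').idx)
    simp only [max_def]
    grind

theorem levelCon_r {w : W} {p q : Nest W M} :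
    (levelCon w).r p q ↔ p = q ∨ (w ≤ p.idx ∧ w ≤ q.idx) := Iff.rfl

theorem copy_collapsed (hM : LatticeCon.IsSimple M) (θ : LatticeCon (Nest W M)) {i : W} {x y : M}
    (h : θ.r ⟨i, x⟩ ⟨i, y⟩) (hxy : x ≠ y) (a b : M) : θ.r ⟨i, a⟩ ⟨i, b⟩ := by
  rcases hM (θ.comap (fun x => ⟨i, x⟩) (fun _ _ => inf_eq.symm) fun _ _ => sup_eq.symm)
    with k | k
  · exact absurd (k x y h) hxy
  · exact k a b

/-- A meet or join with a suitable element of copy `i` turns the pair into two distinct elements of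
that copy. The element is `⟨i, x⟩` itself unless `x` is a bound, when `c` serves. -/
theorem outer_copy_collapsed (hM : LatticeCon.IsSimple M) {c : M} (hc : c ≠ ⊥) (hc' : c ≠ ⊤)
    (θ : LatticeCon (Nest W M)) {i j : W} {x y : M} (h : θ.r ⟨i, x⟩ ⟨j, y⟩) (hij : i < j) (a b : M) :
    θ.r ⟨i, a⟩ ⟨i, b⟩ := by
  by_cases hx : x = ⊤
  · subst hx
    have := θ.inf (θ.refl ⟨i, c⟩) h
    rw [inf_eq, inf_of_lt hij hc', inf_top_eq] at this
    exact copy_collapsed hM θ this hc a b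
  · by_cases hx' : x = ⊥
    · subst hx'
      have := θ.sup (θ.refl ⟨i, c⟩) h
      rw [sup_eq, sup_of_lt hij hc, sup_bot_eq] at this
      exact copy_collapsed hM θ this hc' a b
    · have := θ.sup (θ.refl ⟨i, x⟩) h
      rw [sup_eq, sup_of_lt hij hx', sup_idem] at this
      exact copy_collapsed hM θ this hx a b

/-- Let `w` be the least index of a collapsed copy. All copies further in lie between the bounds of
copy `w`, so they collapse with it by convexity. Conversely, a nontrivial pair collapses the outer
of its two copies, so both of its indices are at least `w`. -/
theorem exists_eq_levelCon [WellFoundedLT W] (hM : LatticeCon.IsSimple M) {c : M} (hc : c ≠ ⊥)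
    (hc' : c ≠ ⊤) (θ : LatticeCon (Nest W M)) :
    θ = LatticeCon.eqCon _ ∨ ∃ w, θ = levelCon w := by
  have key : ∀ p q, θ.r p q → p ≠ q → (∀ a b, θ.r ⟨p.idx, a⟩ ⟨p.idx, b⟩) ∧ p.idx ≤ q.idx ∨
      (∀ a b, θ.r ⟨q.idx, a⟩ ⟨q.idx, b⟩) ∧ q.idx ≤ p.idx := by
    rintro ⟨i, x⟩ ⟨j, y⟩ h hne
    rcases lt_trichotomy i j with l | rfl | l
    · exact .inl ⟨outer_copy_collapsed hM hc hc' θ h l, l.le⟩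
    · exact .inl ⟨copy_collapsed hM θ h fun e => hne (by rw [e]), le_rfl⟩
    · exact .inr ⟨outer_copy_collapsed hM hc hc' θ (θ.symm h) l, l.le⟩
  by_cases h : ∃ i, ∀ a b : M, θ.r ⟨i, a⟩ ⟨i, b⟩
  · obtain ⟨w, hw, hmin⟩ := WellFounded.has_min (wellFounded_lt (α := W))
      {i | ∀ a b : M, θ.r ⟨i, a⟩ ⟨i, b⟩} h
    refine .inr ⟨w, LatticeCon.ext_r fun p q => ?_⟩
    rw [levelCon_r]
    refine ⟨fun hpq => or_iff_not_imp_left.2 fun hne => ?_, ?_⟩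
    · rcases key p q hpq hne with ⟨k, l⟩ | ⟨k, l⟩
      · have := not_lt.1 (hmin _ k)
        exact ⟨this, this.trans l⟩
      · have := not_lt.1 (hmin _ k)
        exact ⟨this.trans l, this⟩
    · rintro (rfl | ⟨hp, hq⟩)
      · exact θ.refl p
      · have := fun z : Nest W M => fun hz : w ≤ z.idx =>
          θ.r_convex (hw ⊥ ⊤) le_rfl (bot_le_of_le hz z.val) (le_top_of_le hz z.val)
        exact θ.trans (θ.symm (this p hp)) (this q hq)
  · refine .inl (LatticeCon.ext_r fun p q => ⟨fun hpq => ?_, fun e => e ▸ θ.refl p⟩)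
    by_contra hne
    rcases key p q hpq hne with ⟨k, -⟩ | ⟨k, -⟩
    · exact h ⟨_, k⟩
    · exact h ⟨_, k⟩

theorem mk_latticeCon [WellFoundedLT W] (hM : LatticeCon.IsSimple M) {c : M} (hc : c ≠ ⊥)
    (hc' : c ≠ ⊤) : #(LatticeCon (Nest W M)) = #W + 1 := by
  rw [← mk_option]
  refine (mk_congr (Equiv.ofBijective
    (fun o : Option W => o.elim (LatticeCon.eqCon (Nest W M)) levelCon) ⟨?_, ?_⟩)).symm
  -- The copies that a congruence collapses determine its level; the identity, at `none`, collapses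
  -- no copy.
  · have hr : ∀ (o : Option W) i, (o.elim (LatticeCon.eqCon (Nest W M)) levelCon).r ⟨i, ⊥⟩ ⟨i, ⊤⟩ ↔
        ∃ w ∈ o, w ≤ i := by
      rintro (_ | w) i
      · exact LatticeCon.eqCon_r.trans (by simp)
      · exact levelCon_r.trans (by simp)
    intro o o' h
    have h' : ∀ i, (∃ w ∈ o, w ≤ i) ↔ ∃ w ∈ o', w ≤ i := fun i =>
      (hr o i).symm.trans ((iff_of_eq (congrArg (fun θ : LatticeCon (Nest W M) =>
        θ.r ⟨i, ⊥⟩ ⟨i, ⊤⟩) h)).trans (hr o' i))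
    rcases o with (_ | w) <;> rcases o' with (_ | w')
    · rfl
    · simpa using h' w'
    · simpa using h' w
    · simp only [Option.mem_def, Option.some.injEq, exists_eq_left'] at h'
      rw [le_antisymm ((h' w').2 le_rfl) ((h' w).1 le_rfl)]
  · intro θ
    rcases exists_eq_levelCon hM hc hc' θ with rfl | ⟨w, rfl⟩
    · exact ⟨none, rfl⟩
    · exact ⟨some w, rfl⟩

/-- The congruence of a nest of two-element chains that, for every `w ∈ T`, separates the elements
of index greater than `w`, the other elements with value `⊥` and the other elements with value `⊤`. -/
def chainCon (hM : ∀ x : M, x = ⊥ ∨ x = ⊤) (T : Set W) : LatticeCon (Nest W M) where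
  r p q := ∀ w ∈ T, ((w < p.idx ↔ w < q.idx) ∧ (¬ w < p.idx → p.val = q.val))
  iseqv := ⟨by grind, by grind, by grind⟩
  -- A nest of two-element chains is a chain, and each `w` cuts it into at most three convex pieces,
  -- so the relation is an intersection of kernels of maps to a three-element chain.
  inf {p q p' q'} h h' w hw := by
    have h1 := h w hw
    have h2 := h' w hw
    change (_ < (min p p').idx ↔ _ < (min q q').idx) ∧ (¬ _ < (min p p').idx →
      (min p p').val = (min q q').val)
    have := hM p.val
    have := hM q.val
    have := hM p'.val
    have := hM q'.val
    have := bot_ne_top (α := M)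
    have := fun x : M => inf_top_eq x
    have := fun x : M => inf_bot_eq x
    simp only [min_def]
    grind
  sup {p q p' q'} h h' w hw := by
    have h1 := h w hw
    have h2 := h' w hw
    change (_ < (max p p').idx ↔ _ < (max q q').idx) ∧ (¬ _ < (max p p').idx →
      (max p p').val = (max q q').val)
    have := hM p.val
    have := hM q.val
    have := hM p'.val
    have := hM q'.val
    have := bot_ne_top (α := M)
    have := fun x : M => sup_top_eq x
    have := fun x : M => sup_bot_eq x
    simp only [max_def]
    grind

end Order

end Nest

/-! ### Ortholattices and Kleene involutions -/

/-- Ortholattices: bounded involution lattices in which the involution is a complementation. -/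
class Ortholattice (A : Type u) extends BoundedInvolutionLattice A where
  inf_kc : ∀ a : A, a ⊓ a′ = ⊥

namespace InvolutionLattice

/-- The involution as an isomorphism with the dual lattice. -/
def kcIso (A : Type u) [InvolutionLattice A] : A ≃o Aᵒᵈ where
  toFun a := .toDual a′
  invFun a := kc a.ofDual
  left_inv := kc_kc (A := A)
  right_inv := kc_kc (A := A)
  map_rel_iff' {a b} := by
    refine ⟨fun h => ?_, fun h => kc_antitone (A := A) _ _ h⟩
    have h' : b′ ≤ a′ := h
    have := kc_antitone _ _ h'
    rwa [kc_kc, kc_kc] at this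

theorem mk_pfilter (A : Type u) [InvolutionLattice A] :
    #(Order.PFilter A) = #(Order.Ideal A) := by
  rw [Order.Ideal.mk_pfilter, Order.Ideal.mk_congr (kcIso A)]

end InvolutionLattice

open InvolutionLattice

namespace Ortholattice

theorem sup_kc {A : Type u} [Ortholattice A] (a : A) : a ⊔ a′ = ⊤ := by
  have h : (a ⊔ a′)′ = ⊥ := by
    rw [← le_bot_iff, ← inf_kc a]
    refine le_inf ?_ (kc_antitone _ _ le_sup_left)
    simpa [kc_kc] using kc_antitone _ _ (le_sup_right : a′ ≤ a ⊔ a′)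
  rw [← top_le_iff]
  have := kc_antitone _ _ (bot_le : ⊥ ≤ (⊤ : A)′)
  rwa [← h, kc_kc, kc_kc] at this

instance ofBooleanAlgebra (B : Type u) [BooleanAlgebra B] : Ortholattice B where
  kc a := aᶜ
  kc_antitone _ _ := compl_le_compl
  kc_kc := compl_compl
  inf_kc := inf_compl_self

end Ortholattice

/-- The horizontal sum of an ortholattice with `S` pairs of complementary atoms. -/
noncomputable instance HSum.instOrtholattice {B S : Type u} [Ortholattice B] [Nontrivial B] :
    Ortholattice (HSum B (S × Bool)) where
  __ := (inferInstance : Lattice (HSum B (S × Bool)))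
  __ := (inferInstance : BoundedOrder (HSum B (S × Bool)))
  kc
    | base a => base a′
    | atom x => atom (x.1, !x.2)
  kc_antitone := by
    rintro (a | x) (b | y) h
    · exact kc_antitone _ _ h
    · obtain rfl : a = ⊥ := h
      change (⊥ : B)′ = ⊤
      simpa using Ortholattice.sup_kc (⊥ : B)
    · obtain rfl : b = ⊤ := h
      change (⊤ : B)′ = ⊥
      simpa using Ortholattice.inf_kc (⊤ : B)
    · obtain rfl : x = y := h
      exact le_rfl (a := (atom (x.1, !x.2) : HSum B (S × Bool)))
  kc_kc := by rintro (a | x) <;> simp [kc_kc]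
  inf_kc := by
    rintro (a | x)
    · exact congrArg base (Ortholattice.inf_kc a)
    · exact atom_inf_atom fun h => by simpa using congrArg Prod.snd h

namespace Nest

/-- Nests of an ortholattice are pseudo-Kleene algebras. -/
noncomputable instance {W M : Type u} [LinearOrder W] [OrderBot W] [Ortholattice M]
    [Nontrivial M] : PseudoKleeneAlgebra (Nest W M) where
  __ := (inferInstance : Lattice (Nest W M))
  __ := (inferInstance : BoundedOrder (Nest W M))
  kc z := ⟨z.idx, z.val′⟩
  kc_antitone p q h := by
    have hb : (⊥ : M)′ = ⊤ := by simpa using Ortholattice.sup_kc (⊥ : M)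
    have ht : (⊤ : M)′ = ⊥ := by simpa using Ortholattice.inf_kc (⊤ : M)
    rcases le_def.1 h with ⟨h, k⟩ | ⟨h, k⟩ | ⟨h, k⟩
    · exact .inl ⟨h.symm, kc_antitone _ _ k⟩
    · exact .inr (.inr ⟨h, by rw [k, hb]⟩)
    · exact .inr (.inl ⟨h, by rw [k, ht]⟩)
  kc_kc z := by simp [kc_kc]
  kleene := by
    rintro ⟨i, x⟩ ⟨j, y⟩
    -- The left side is the bottom of a copy and the right side the top of one; in a nest every
    -- bottom lies below every top.
    change (⟨i, x⟩ ⊓ ⟨i, x′⟩ : Nest W M) ≤ ⟨j, y⟩ ⊔ ⟨j, y′⟩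
    rw [inf_eq, sup_eq, Ortholattice.inf_kc, Ortholattice.sup_kc]
    rcases le_total i j with h | h
    · exact bot_le_of_le h ⊤
    · exact le_top_of_le h ⊥

section Congruences

variable {W M : Type u} [LinearOrder W] [OrderBot W] [Ortholattice M] [Nontrivial M]

/-- Apart from equality, a level congruence depends only on indices, which the involution fixes. -/
theorem conI_eq_univ [WellFoundedLT W] (hM : LatticeCon.IsSimple M) {c : M} (hc : c ≠ ⊥)
    (hc' : c ≠ ⊤) : conI (Nest W M) = Set.univ := by
  refine Set.eq_univ_of_forall fun θ => ?_
  rcases exists_eq_levelCon hM hc hc' θ with rfl | ⟨w, rfl⟩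
  · rintro a b (rfl : a = b)
    exact rfl
  · rintro a b (rfl | ⟨ha, hb⟩)
    · exact .inl rfl
    · exact .inr ⟨ha, hb⟩

end Congruences

end Nest

section Product

variable (A B : Type u) [PseudoKleeneAlgebra A] [PseudoKleeneAlgebra B]

/-- Products of pseudo-Kleene algebras. -/
instance Prod.instPseudoKleeneAlgebra : PseudoKleeneAlgebra (A × B) where
  kc p := (p.1′, p.2′)
  kc_antitone _ _ h := ⟨kc_antitone _ _ h.1, kc_antitone _ _ h.2⟩
  kc_kc p := Prod.ext (kc_kc p.1) (kc_kc p.2)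
  kleene p q := ⟨PseudoKleeneAlgebra.kleene p.1 q.1, PseudoKleeneAlgebra.kleene p.2 q.2⟩

end Product

/-! ### Simple lattices with few or many ideals and filters -/

/-- The symmetric difference of two congruent elements is congruent to `⊥`. -/
theorem HSum.BoundsCollapse.of_booleanAlgebra (B : Type u) [BooleanAlgebra B] :
    HSum.BoundsCollapse B := by
  intro θ a b h hne
  refine .inl ⟨(a ⊔ b) ⊓ (a ⊓ b)ᶜ, fun h0 => hne ?_, ?_⟩
  · have : a ⊔ b ≤ a ⊓ b := by
      rwa [← disjoint_iff, disjoint_compl_right_iff] at h0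
    exact inf_eq_sup.1 (le_antisymm inf_le_sup this)
  · have := θ.inf (θ.r_inf_sup_iff.2 h) (θ.refl (a ⊓ b)ᶜ)
    rwa [inf_compl_self] at this

/-- A pair involving `⊤` is already of the required kind; below `⊤`, set difference replaces the
complement. -/
theorem HSum.BoundsCollapse.withTop_finset (S : Type u) [DecidableEq S] :
    HSum.BoundsCollapse (WithTop (Finset S)) := by
  intro θ a b h hne
  have hlt : a ⊓ b < a ⊔ b := inf_lt_sup.2 hne
  have h := θ.r_inf_sup_iff.2 h
  generalize a ⊓ b = u at *
  generalize a ⊔ b = v at *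
  induction v with
  | top => exact .inr ⟨u, hlt.ne, h⟩
  | coe V =>
    induction u with
    | top => exact absurd hlt not_top_lt
    | coe U =>
      refine .inl ⟨((V \ U : Finset S) : WithTop (Finset S)), ?_, ?_⟩
      · intro h0
        have : V \ U = ∅ := WithTop.coe_injective h0
        exact (WithTop.coe_lt_coe.1 hlt).not_ge (Finset.sdiff_eq_empty_iff_subset.1 this)
      · have := θ.inf h (θ.refl ((V \ U : Finset S) : WithTop (Finset S)))
        rwa [← WithTop.coe_inf, ← WithTop.coe_inf, inf_sdiff_self_right,
          inf_eq_right.2 (sdiff_le : V \ U ≤ V)] at this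

/-- The finite and the cofinite subsets of a set. -/
def finCofin (S : Type u) : BooleanSubalgebra (Set S) where
  carrier := {X | X.Finite ∨ Xᶜ.Finite}
  supClosed' := by
    rintro X (hX | hX) Y (hY | hY)
    · exact .inl (hX.union hY)
    · exact .inr (hY.subset (Set.compl_subset_compl.2 Set.subset_union_right))
    · exact .inr (hX.subset (Set.compl_subset_compl.2 Set.subset_union_left))
    · exact .inr (hX.subset (Set.compl_subset_compl.2 Set.subset_union_left))
  infClosed' := by
    rintro X (hX | hX) Y (hY | hY)
    · exact .inl (hX.subset Set.inter_subset_left)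
    · exact .inl (hX.subset Set.inter_subset_left)
    · exact .inl (hY.subset Set.inter_subset_right)
    · refine .inr ?_
      change (X ∩ Y)ᶜ.Finite
      rw [Set.compl_inter]
      exact hX.union hY
  compl_mem' := by
    rintro X (hX | hX)
    · exact .inr (by simpa using hX)
    · exact .inl hX
  bot_mem' := .inl Set.finite_empty

theorem mk_finCofin_le (S : Type u) [Infinite S] : #(finCofin S) ≤ #S := by
  classical
  have h : #(finCofin S) ≤ #(Finset S × Bool) := by
    refine mk_le_of_surjective (f := fun p : Finset S × Bool =>
      if p.2 then ⟨↑p.1, .inl p.1.finite_toSet⟩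
      else ⟨(↑p.1)ᶜ, .inr (by simp [p.1.finite_toSet])⟩) ?_
    rintro ⟨X, hX | hX⟩
    · exact ⟨(hX.toFinset, true), by simp⟩
    · exact ⟨(hX.toFinset, false), by simp⟩
  refine h.trans ?_
  rw [mk_prod, mk_finset_of_infinite]
  simp only [lift_uzero, mk_bool, lift_ofNat]
  exact mul_le_of_le (aleph0_le_mk S) le_rfl (natCast_lt_aleph0.le.trans (aleph0_le_mk S))

/-- The finite sets as finite or cofinite sets. -/
def finsetToFinCofin (S : Type u) : Finset S ↪o finCofin S where
  toFun X := ⟨X, .inl X.finite_toSet⟩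
  inj' X Y h := Finset.coe_injective (congrArg Subtype.val h)
  map_rel_iff' := by
    intro X Y
    change (X : Set S) ⊆ Y ↔ X ≤ Y
    simp

/-- The finite subsets of `T` form an ideal, and its singletons recover `T`. -/
theorem two_power_le_mk_ideal_finset (S : Type u) : 2 ^ #S ≤ #(Order.Ideal (Finset S)) := by
  classical
  rw [← mk_set]
  refine mk_le_of_injective (f := fun T : Set S => (⟨⟨{X | (X : Set S) ⊆ T},
    fun X Y h hX => (Finset.coe_subset.2 h).trans hX⟩, ⟨∅, by simp⟩,
    fun X hX Y hY => ⟨X ∪ Y, by simpa using ⟨hX, hY⟩, Finset.subset_union_left,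
      Finset.subset_union_right⟩⟩ : Order.Ideal (Finset S))) fun T T' h => ?_
  ext x
  have := iff_of_eq (congrArg (fun I : Order.Ideal (Finset S) => {x} ∈ I) h)
  have key : ∀ T : Set S, ((({x} : Finset S) : Set S) ⊆ T) ↔ x ∈ T := by simp
  exact (key T).symm.trans (this.trans (key T'))

theorem LatticeCon.IsSimple.dual {M : Type u} [Lattice M] (h : LatticeCon.IsSimple M) :
    LatticeCon.IsSimple Mᵒᵈ := fun θ => h (LatticeCon.dualEquiv.symm θ)

theorem mk_prod_bool (S : Type u) [Infinite S] : #(S × Bool) = #S := by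
  simp only [mk_prod, lift_uzero, mk_bool, lift_ofNat]
  exact mul_eq_left (aleph0_le_mk S) (natCast_lt_aleph0.le.trans (aleph0_le_mk S)) two_ne_zero

theorem HSum.mk_atomPairs {B S : Type u} [Infinite S] (hB : #B ≤ #S) : #(HSum B (S × Bool)) = #S := by
  rw [HSum.mk_eq, mk_prod_bool, add_eq_right (aleph0_le_mk S) hB]

section HSum

variable {B S : Type u} [Lattice B] [BoundedOrder B] [Nontrivial B] [Infinite S]

theorem HSum.isSimple_atomPairs (hB : HSum.BoundsCollapse B) :
    LatticeCon.IsSimple (HSum B (S × Bool)) := by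
  classical
  refine HSum.isSimple hB fun x y => ?_
  obtain ⟨z, hz⟩ := Infinite.exists_notMem_finset {x, y}
  simp only [Finset.mem_insert, Finset.mem_singleton, not_or] at hz
  exact ⟨z, hz⟩

theorem HSum.mk_ideal_atomPairs_le : #(Order.Ideal (HSum B (S × Bool))) ≤ #(Order.Ideal B) + #S :=
  HSum.mk_ideal_le.trans (by rw [mk_prod_bool])

end HSum

/-- The `ν` pairs of atoms fix the size, and the base decides the ideals: the two-element Boolean
algebra contributes finitely many, the finite-cofinite algebra `2 ^ ν`. -/
theorem exists_simple_ortholattice {ν ι : Cardinal.{u}} (hν : ℵ₀ ≤ ν) (hι : ι = ν ∨ ι = 2 ^ ν) :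
    ∃ (M : Type u) (_ : Ortholattice M) (_ : Nontrivial M), LatticeCon.IsSimple M ∧
      (∃ c : M, c ≠ ⊥ ∧ c ≠ ⊤) ∧ #M = ν ∧ #(Order.Ideal M) = ι := by
  obtain ⟨S, rfl⟩ : ∃ S : Type u, #S = ν := ⟨ν.out, mk_out ν⟩
  have : Infinite S := infinite_iff.2 hν
  have s : S := Classical.arbitrary S
  rcases hι with rfl | rfl
  · have hB : #(Set PUnit.{u + 1}) ≤ #S := (Cardinal.lt_aleph0_of_finite _).le.trans hν
    have hM : #(HSum (Set PUnit.{u + 1}) (S × Bool)) = #S := HSum.mk_atomPairs hB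
    refine ⟨HSum (Set PUnit.{u + 1}) (S × Bool), inferInstance, inferInstance,
      HSum.isSimple_atomPairs (.of_booleanAlgebra _), ⟨.atom (s, true), HSum.atom_ne_bot _,
      HSum.atom_ne_top _⟩, hM, le_antisymm ?_ ?_⟩
    · refine HSum.mk_ideal_atomPairs_le.trans (add_le_of_le hν ?_ le_rfl)
      exact (Order.Ideal.mk_le_of_wellFoundedGT _).trans hB
    · exact hM.ge.trans (Order.Ideal.mk_type_le _)
  · have : Nontrivial (finCofin S) := ⟨⟨⊥, ⊤, fun h => by
      have := congrArg Subtype.val h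
      exact Set.empty_ne_univ this⟩⟩
    have hM : #(HSum (finCofin S) (S × Bool)) = #S := HSum.mk_atomPairs (mk_finCofin_le S)
    refine ⟨HSum (finCofin S) (S × Bool), inferInstance, inferInstance,
      HSum.isSimple_atomPairs (.of_booleanAlgebra _), ⟨.atom (s, true), HSum.atom_ne_bot _,
      HSum.atom_ne_top _⟩, hM, le_antisymm ?_ ?_⟩
    · exact (Order.Ideal.mk_le_two_power _).trans (by rw [hM])
    · exact (two_power_le_mk_ideal_finset S).trans
        ((Order.Ideal.mk_le_of_orderEmbedding (finsetToFinCofin S)).trans HSum.le_mk_ideal)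

/-- Finite sets have `2 ^ ν` ideals, but inclusion between them is well-founded, so all their
filters are principal; the added top, needed for boundedness, preserves both facts. -/
theorem exists_simple_lattice_few_filters {ν : Cardinal.{u}} (hν : ℵ₀ ≤ ν) :
    ∃ (M : Type u) (_ : Lattice M) (_ : BoundedOrder M) (_ : Nontrivial M),
      LatticeCon.IsSimple M ∧ (∃ c : M, c ≠ ⊥ ∧ c ≠ ⊤) ∧ #M = ν ∧ #(Order.Ideal M) = 2 ^ ν ∧
      #(Order.Ideal Mᵒᵈ) = ν := by
  classical
  obtain ⟨S, rfl⟩ : ∃ S : Type u, #S = ν := ⟨ν.out, mk_out ν⟩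
  have : Infinite S := infinite_iff.2 hν
  have s : S := Classical.arbitrary S
  have hB : #(WithTop (Finset S)) ≤ #S := by
    change #(Option (Finset S)) ≤ _
    rw [mk_option, mk_finset_of_infinite]
    exact (add_one_of_aleph0_le hν).le
  have hM : #(HSum (WithTop (Finset S)) (S × Bool)) = #S := HSum.mk_atomPairs hB
  refine ⟨HSum (WithTop (Finset S)) (S × Bool), inferInstance, inferInstance, inferInstance,
    HSum.isSimple_atomPairs (.withTop_finset S), ⟨.atom (s, true), HSum.atom_ne_bot _,
    HSum.atom_ne_top _⟩, hM, le_antisymm ?_ ?_, le_antisymm ?_ ?_⟩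
  · exact (Order.Ideal.mk_le_two_power _).trans (by rw [hM])
  · exact (two_power_le_mk_ideal_finset S).trans
      ((Order.Ideal.mk_le_of_orderEmbedding WithTop.coeOrderHom).trans HSum.le_mk_ideal)
  · rw [Order.Ideal.mk_congr HSum.dualIso]
    refine HSum.mk_ideal_atomPairs_le.trans (add_le_of_le hν ?_ le_rfl)
    exact (Order.Ideal.mk_le_of_wellFoundedGT _).trans hB
  · exact hM.ge.trans (Order.Ideal.mk_type_le (HSum (WithTop (Finset S)) (S × Bool))ᵒᵈ)

/-! ### Index orders and cardinalities of nests -/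

theorem exists_wellOrder_add_one {κ : Cardinal.{u}} (hκ : 2 ≤ κ) :
    ∃ (W : Type u) (_ : LinearOrder W) (_ : OrderBot W), WellFoundedLT W ∧ #W + 1 = κ := by
  -- The extra `1` is the identity congruence of the nest; an infinite `κ` absorbs it.
  obtain ⟨κ', hκ'⟩ : ∃ κ', κ' + 1 = κ := by
    rcases lt_or_ge κ ℵ₀ with h | h
    · obtain ⟨n, rfl⟩ := lt_aleph0.1 h
      have hn : 1 ≤ n := by
        have : 2 ≤ n := by exact_mod_cast hκ
        omega
      exact ⟨(n - 1 : ℕ), by exact_mod_cast Nat.sub_add_cancel hn⟩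
    · exact ⟨κ, add_one_of_aleph0_le h⟩
  have h0 : κ' ≠ 0 := by
    rintro rfl
    rw [zero_add] at hκ'
    rw [← hκ'] at hκ
    exact absurd hκ (by norm_num)
  have : Nonempty κ'.ord.ToType := mk_ne_zero_iff.1 (by rwa [mk_ord_toType])
  exact ⟨κ'.ord.ToType, inferInstance, WellFoundedLT.toOrderBot _, inferInstance,
    by rw [mk_ord_toType, hκ']⟩

theorem exists_wellOrder_noMaxOrder {κ : Cardinal.{u}} (hκ : ℵ₀ ≤ κ) :
    ∃ (W : Type u) (_ : LinearOrder W) (_ : OrderBot W),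
      WellFoundedLT W ∧ NoMaxOrder W ∧ #W = κ := by
  have h := Cardinal.noMaxOrder hκ
  have : Nonempty κ.ord.ToType :=
    mk_ne_zero_iff.1 (by rw [mk_ord_toType]; exact (aleph0_pos.trans_le hκ).ne')
  exact ⟨κ.ord.ToType, inferInstance, WellFoundedLT.toOrderBot _, inferInstance, h,
    mk_ord_toType κ⟩

namespace Nest

theorem mk_nest_eq {W M : Type u} [Nonempty W] (hM : ℵ₀ ≤ #M) (hW : #W ≤ #M) :
    #(Nest W M) = #M := by
  rw [mk_eq]
  exact mul_eq_right hM hW (mk_ne_zero W)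

theorem mk_prod_nest_eq {W M N : Type u} [Nonempty W] [Nonempty N] [Finite N] (hM : ℵ₀ ≤ #M)
    (hW : #W ≤ #M) : #(M × Nest W N) = #M := by
  have hN := (lt_aleph0_of_finite N).le.trans hM
  rw [← mul_def, mk_eq]
  exact mul_eq_left hM (mul_le_of_le hM hW hN) (mul_ne_zero (mk_ne_zero W) (mk_ne_zero N))

section Cardinality

variable {W M N : Type u} [LinearOrder W] [OrderBot W] [WellFoundedLT W]
  [Lattice M] [BoundedOrder M] [Lattice N] [BoundedOrder N] [Nontrivial N]

theorem mk_ideal_eq [Nontrivial M] (hM : ℵ₀ ≤ #M) (hW : #W ≤ #M) :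
    #(Order.Ideal (Nest W M)) = #(Order.Ideal M) := by
  have hI : #M ≤ #(Order.Ideal M) := Order.Ideal.mk_type_le M
  have h := hM.trans hI
  refine le_antisymm (mk_ideal_le.trans (add_le_of_le h ?_ ?_)) le_mk_ideal
  · exact mul_le_of_le h (hW.trans hI) le_rfl
  · exact (Order.Ideal.mk_le_of_wellFoundedLT W).trans
      (add_le_of_le h (hW.trans hI) (one_le_aleph0.trans h))

theorem mk_ideal_prod_eq [Finite N] (hM : ℵ₀ ≤ #M) (hW : #W ≤ #M) :
    #(Order.Ideal (M × Nest W N)) = #(Order.Ideal M) := by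
  have hI : #M ≤ #(Order.Ideal M) := Order.Ideal.mk_type_le M
  have hN : #(Order.Ideal N) ≤ #M :=
    (Order.Ideal.mk_le_of_wellFoundedGT N).trans ((lt_aleph0_of_finite N).le.trans hM)
  refine le_antisymm ((Order.Ideal.mk_prod_le _ _).trans (mul_le_of_le (hM.trans hI) le_rfl
    ((mk_ideal_le.trans (add_le_of_le hM ?_ ?_)).trans hI)))
    (Order.Ideal.mk_le_of_orderEmbedding
      (OrderEmbedding.ofMapLEIff (fun x : M => (x, (⊥ : Nest W N))) fun x y => by simp))
  · exact mul_le_of_le hM hW hN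
  · exact (Order.Ideal.mk_le_of_wellFoundedLT W).trans
      (add_le_of_le hM hW (one_le_aleph0.trans hM))

end Cardinality

section ProductCongruences

variable {W M N : Type u} [LinearOrder W] [Lattice M] [Lattice N] [BoundedOrder N] [Nontrivial N]

/-- The congruences of a product that are induced by those of a nest of two-element chains. -/
noncomputable def prodChainCon (hN : ∀ x : N, x = ⊥ ∨ x = ⊤) (T : Set W) : LatticeCon (M × Nest W N) :=
  (chainCon hN T).comap Prod.snd (fun _ _ => rfl) fun _ _ => rfl

/-- The congruence of `T` separates the tops of index `w` and `Order.succ w` exactly when `w ∈ T`.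
With no maximum in `W`, these indices differ for every `w`. -/
theorem prodChainCon_injective [OrderBot M] [WellFoundedLT W] [NoMaxOrder W]
    (hN : ∀ x : N, x = ⊥ ∨ x = ⊤) :
    Function.Injective (prodChainCon (M := M) hN : Set W → _) := by
  have : SuccOrder W := .ofLinearWellFoundedLT W
  have key : ∀ (T : Set W) (w : W),
      (prodChainCon (M := M) hN T).r (⊥, ⟨w, ⊤⟩) (⊥, ⟨Order.succ w, ⊤⟩) ↔ w ∉ T := by
    intro T w
    change (∀ v ∈ T, ((v < w ↔ v < Order.succ w) ∧ (¬ v < w → (⊤ : N) = ⊤))) ↔ w ∉ T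
    simp only [Order.lt_succ_iff, implies_true, and_true]
    refine ⟨fun h hw => lt_irrefl w ((h w hw).2 le_rfl), fun h v hv => ⟨le_of_lt, fun hvw => ?_⟩⟩
    exact lt_of_le_of_ne hvw fun e => h (e ▸ hv)
  intro T T' h
  ext w
  exact not_iff_not.1 ((key T w).symm.trans ((iff_of_eq (congrArg
    (fun θ : LatticeCon (M × Nest W N) => θ.r (⊥, ⟨w, ⊤⟩) (⊥, ⟨Order.succ w, ⊤⟩)) h)).trans
    (key T' w)))

end ProductCongruences

end Nest

/-- Duality of products with nests. -/
def prodNestDualIso (M W N : Type u) [Lattice M] [LinearOrder W] [Lattice N] [BoundedOrder N]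
    [Nontrivial N] : (M × Nest W N)ᵒᵈ ≃o Mᵒᵈ × Nest W Nᵒᵈ where
  toFun z := (.toDual z.ofDual.1, Nest.dualIso (.toDual z.ofDual.2))
  invFun z := .toDual (z.1.ofDual, (Nest.dualIso.symm z.2).ofDual)
  left_inv _ := rfl
  right_inv _ := rfl
  map_rel_iff' := and_congr Iff.rfl Nest.dualIso.le_iff_le

theorem mk_latticeCon_le {A : Type u} [Lattice A] (hA : ℵ₀ ≤ #A) : #(LatticeCon A) ≤ 2 ^ #A :=
  (LatticeCon.mk_le_two_power A).trans (by rw [mul_eq_self hA])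

theorem set_pUnit_eq (x : Set PUnit.{u + 1}) : x = ⊥ ∨ x = ⊤ :=
  x.eq_empty_or_nonempty.imp_right fun h => h.eq_univ

/-! ### Lattices and pseudo-Kleene algebras with prescribed congruences -/

/-- For `κ ≤ #M` the nest of copies of `M` serves. For `κ = 2 ^ #M`, the factor `M` supplies the
ideals and filters and the nest of two-element chains the congruences. -/
theorem exists_lattice_of_isSimple {M : Type u} [Lattice M] [BoundedOrder M] [Nontrivial M]
    (hM : LatticeCon.IsSimple M) (hc : ∃ c : M, c ≠ ⊥ ∧ c ≠ ⊤) (hν : ℵ₀ ≤ #M) {κ : Cardinal.{u}}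
    (h2 : 2 ≤ κ) (hκ : κ ≤ #M ∨ κ = 2 ^ #M) :
    ∃ (L : Type u) (_ : Lattice L) (_ : BoundedOrder L), #L = #M ∧
      #(Order.PFilter L) = #(Order.Ideal Mᵒᵈ) ∧ #(Order.Ideal L) = #(Order.Ideal M) ∧
      #(LatticeCon L) = κ := by
  have hν' : ℵ₀ ≤ #Mᵒᵈ := hν
  rcases hκ with hκ | rfl
  · obtain ⟨c, hc, hc'⟩ := hc
    obtain ⟨W, _, _, _, rfl⟩ := exists_wellOrder_add_one h2
    have hW : #W ≤ #M := le_self_add.trans hκ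
    refine ⟨Nest W M, inferInstance, inferInstance, Nest.mk_nest_eq hν hW, ?_,
      Nest.mk_ideal_eq hν hW, Nest.mk_latticeCon hM hc hc'⟩
    rw [Order.Ideal.mk_pfilter, Order.Ideal.mk_congr Nest.dualIso]
    exact Nest.mk_ideal_eq hν' hW
  · obtain ⟨W, _, _, _, _, hWc⟩ := exists_wellOrder_noMaxOrder hν
    have hL : #(M × Nest W (Set PUnit.{u + 1})) = #M := Nest.mk_prod_nest_eq hν hWc.le
    refine ⟨M × Nest W (Set PUnit.{u + 1}), inferInstance, inferInstance, hL, ?_,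
      Nest.mk_ideal_prod_eq hν hWc.le, le_antisymm ?_ ?_⟩
    · have : Finite (Set PUnit.{u + 1})ᵒᵈ := inferInstanceAs (Finite (Set PUnit.{u + 1}))
      rw [Order.Ideal.mk_pfilter, Order.Ideal.mk_congr (prodNestDualIso _ _ _)]
      exact Nest.mk_ideal_prod_eq hν' hWc.le
    · exact (mk_latticeCon_le (hν.trans hL.ge)).trans (by rw [hL])
    · rw [← hWc, ← mk_set]
      exact mk_le_of_injective (Nest.prodChainCon_injective set_pUnit_eq)

theorem exists_pseudoKleene_of_isSimple {M : Type u} [Ortholattice M] [Nontrivial M]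
    (hM : LatticeCon.IsSimple M) (hc : ∃ c : M, c ≠ ⊥ ∧ c ≠ ⊤) (hν : ℵ₀ ≤ #M) {κ : Cardinal.{u}}
    (h2 : 2 ≤ κ) (hκ : κ ≤ #M ∨ κ = 2 ^ #M) :
    ∃ (A : Type u) (_ : PseudoKleeneAlgebra A), #A = #M ∧
      #(Order.Ideal A) = #(Order.Ideal M) ∧ #(conI A) = κ ∧
      (κ < 2 ^ #M → conI A = Set.univ) := by
  rcases hκ with hκ | rfl
  · obtain ⟨c, hc, hc'⟩ := hc
    obtain ⟨W, _, _, _, rfl⟩ := exists_wellOrder_add_one h2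
    have hW : #W ≤ #M := le_self_add.trans hκ
    have hI : conI (Nest W M) = Set.univ := Nest.conI_eq_univ hM hc hc'
    refine ⟨Nest W M, inferInstance, Nest.mk_nest_eq hν hW, Nest.mk_ideal_eq hν hW, ?_,
      fun _ => hI⟩
    rw [hI, mk_univ]
    exact Nest.mk_latticeCon hM hc hc'
  · obtain ⟨W, _, _, _, _, hWc⟩ := exists_wellOrder_noMaxOrder hν
    let _ : PseudoKleeneAlgebra M :=
      { kleene := fun a b => by rw [Ortholattice.inf_kc]; exact bot_le }
    have hA : #(M × Nest W (Set PUnit.{u + 1})) = #M := Nest.mk_prod_nest_eq hν hWc.le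
    refine ⟨M × Nest W (Set PUnit.{u + 1}), inferInstance, hA,
      Nest.mk_ideal_prod_eq hν hWc.le, le_antisymm ?_ ?_, fun h => absurd h (lt_irrefl _)⟩
    · exact (mk_set_le _).trans
        ((mk_latticeCon_le (A := M × Nest W (Set PUnit.{u + 1})) (hν.trans hA.ge)).trans
          (by rw [hA]))
    · rw [← hWc, ← mk_set]
      refine mk_le_of_injective (f := fun T : Set W => (⟨Nest.prodChainCon set_pUnit_eq T,
        fun a b h w hw => ⟨(h w hw).1, fun hw' => ?_⟩⟩ :
        conI (M × Nest W (Set PUnit.{u + 1})))) fun T T' h =>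
          Nest.prodChainCon_injective set_pUnit_eq (congrArg Subtype.val h)
      -- The involution keeps indices, and applying it to equal values keeps them equal.
      exact congrArg kc ((h w hw).2 hw')

theorem latticeRealization {ν : Cardinal.{u}} (hν : ℵ₀ ≤ ν) (hsucc : 2 ^ ν = Order.succ ν) :
    LatticeRealization ν := by
  have dich : ∀ {μ : Cardinal.{u}}, μ ≤ 2 ^ ν → μ ≤ ν ∨ μ = 2 ^ ν := fun {μ} h =>
    h.lt_or_eq.imp_left fun h => Order.lt_succ_iff.1 (hsucc ▸ h)
  intro φ ι κ hφ hφ' hι hι' h2 hκ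
  have key : ∃ (M : Type u) (_ : Lattice M) (_ : BoundedOrder M) (_ : Nontrivial M),
      LatticeCon.IsSimple M ∧ (∃ c : M, c ≠ ⊥ ∧ c ≠ ⊤) ∧ #M = ν ∧ #(Order.Ideal Mᵒᵈ) = φ ∧
      #(Order.Ideal M) = ι := by
    -- Equal numbers come from a self-dual `M`; if they differ, one is `ν` and the other `2 ^ ν`,
    -- realized by the few-filters lattice or its dual.
    by_cases hφι : φ = ι
    · obtain ⟨M, _, _, hM, hc, hMν, hMι⟩ :=
        exists_simple_ortholattice hν ((dich hι').imp_left fun h => le_antisymm h hι)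
      exact ⟨M, inferInstance, inferInstance, inferInstance, hM, hc, hMν,
        by rw [← Order.Ideal.mk_congr (kcIso M), hMι, hφι], hMι⟩
    · obtain ⟨M, _, _, _, hM, ⟨c, hc⟩, hMν, hI, hF⟩ := exists_simple_lattice_few_filters hν
      rcases dich hφ' with h | rfl <;> rcases dich hι' with k | rfl
      · exact absurd ((le_antisymm h hφ).trans (le_antisymm hι k)) hφι
      · exact ⟨M, inferInstance, inferInstance, inferInstance, hM, ⟨c, hc⟩, hMν,
          hF.trans (le_antisymm hφ h), hI⟩
      · exact ⟨Mᵒᵈ, inferInstance, inferInstance, inferInstance, hM.dual, ⟨.toDual c, hc.symm⟩,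
          hMν, hI, hF.trans (le_antisymm hι k)⟩
      · exact absurd rfl hφι
  obtain ⟨M, _, _, _, hM, hc, rfl, rfl, rfl⟩ := key
  exact exists_lattice_of_isSimple hM hc hν h2 (dich hκ)

theorem pseudoKleeneRealization {ν : Cardinal.{u}} (hν : ℵ₀ ≤ ν) (hsucc : 2 ^ ν = Order.succ ν) :
    PseudoKleeneRealization ν := by
  have dich : ∀ {μ : Cardinal.{u}}, μ ≤ 2 ^ ν → μ ≤ ν ∨ μ = 2 ^ ν := fun {μ} h =>
    h.lt_or_eq.imp_left fun h => Order.lt_succ_iff.1 (hsucc ▸ h)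
  intro ι κ hι hι' h2 hκ
  obtain ⟨M, _, _, hM, hc, rfl, rfl⟩ :=
    exists_simple_ortholattice hν ((dich hι').imp_left fun h => le_antisymm h hι)
  exact exists_pseudoKleene_of_isSimple hM hc hν h2 (dich hκ)

/-! ### Antiortholattices with the trivial Brouwer complement -/

namespace PseudoKleeneAlgebra

variable {A : Type u} [PseudoKleeneAlgebra A]

theorem kc_bot : (⊥ : A)′ = ⊤ := by
  rw [← top_le_iff]
  simpa [kc_kc] using kc_antitone _ _ (bot_le : ⊥ ≤ (⊤ : A)′)

theorem kc_top : (⊤ : A)′ = ⊥ := by rw [← kc_bot, kc_kc]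

theorem kc_eq_bot {a : A} : a′ = ⊥ ↔ a = ⊤ :=
  ⟨fun h => by rw [← kc_kc a, h, kc_bot], fun h => by rw [h, kc_top]⟩

open Classical in
/-- The trivial Brouwer complement makes an antiortholattice of a pseudo-Kleene algebra in which
only the bounds are complemented by the involution. -/
noncomputable abbrev toAntiortholattice (h : ∀ a : A, a ⊓ a′ = ⊥ → a = ⊥ ∨ a = ⊤) :
    Antiortholattice A where
  bc a := if a = ⊥ then ⊤ else ⊥
  bc_antitone a b hab := by
    by_cases hb : b = ⊥
    · subst hb; rw [le_bot_iff.1 hab]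
    · simp [hb]
  inf_bc a := by by_cases ha : a = ⊥ <;> simp [ha]
  le_bc_bc a := by
    by_cases ha : a = ⊥
    · simp [ha]
    · simp [ha]
  bc_bc a := by
    by_cases ha : a = ⊥
    -- The one-element algebra is not excluded, and there `⊤` also counts as `⊥`.
    · by_cases hA : (⊤ : A) = ⊥ <;> simp [ha, hA, kc_top, kc_bot]
    · simp [ha, kc_bot]
  paraorthomodular a b hab hb := by
    -- From `a ≤ b` it follows that `a ⊓ a′ ≤ a′ ⊓ b = ⊥`, so `a` is a bound.
    rcases h a (le_bot_iff.1 ((inf_comm a a′ ▸ inf_le_inf_left _ hab).trans hb.le)) with rfl | rfl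
    · rw [kc_bot, top_inf_eq] at hb
      exact hb.symm
    · exact (top_le_iff.1 hab).symm
  star a := by
    by_cases ha : a ⊓ a′ = ⊥
    · rcases h a ha with rfl | rfl <;> simp [kc_top]
    · have h1 : a ≠ ⊥ := fun e => ha (by simp [e])
      have h2 : a′ ≠ ⊥ := fun e => ha (by simp [e])
      simp [ha, h1, h2]
  eq_bot_or_eq_top a ha := h a ha.inf_eq_bot

variable [Nontrivial A] (h : ∀ a : A, a ⊓ a′ = ⊥ → a = ⊥ ∨ a = ⊤)

theorem isProperCon_of_mem_con01 {θ : LatticeCon A} (hθ : θ ∈ con01 A) : IsProperCon θ :=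
  fun hf => top_ne_bot (hθ.1 ⊤ (hf ⊥ ⊤))

/-- The complement `∼` sends `⊥` to `⊤` and all else to `⊥`. Preserving it thus means that `⊥` is
congruent to nothing else, unless the congruence is full; the involution carries this over to `⊤`.
-/
theorem properConBZ_eq :
    {θ ∈ @conBZ A (toAntiortholattice h).toBZLattice | IsProperCon θ} = con01 A ∩ conI A := by
  let _ := toAntiortholattice h
  have bcb : (⊥ : A)∼ = ⊤ := if_pos rfl
  have bca : ∀ a : A, a ≠ ⊥ → a∼ = ⊥ := fun a ha => if_neg ha
  ext θ
  constructor
  · rintro ⟨⟨hk, hb⟩, hp⟩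
    have h0 : ∀ a, θ.r ⊥ a → a = ⊥ := fun a ha => by
      by_contra hne
      have := hb _ _ ha
      rw [bcb, bca a hne] at this
      exact hp (θ.full_of_bot_top (θ.symm this))
    refine ⟨⟨h0, fun a ha => ?_⟩, hk⟩
    have := hk _ _ ha
    rw [kc_top] at this
    exact kc_eq_bot.1 (h0 _ this)
  · rintro ⟨h01, hk⟩
    refine ⟨⟨hk, fun a b hab => ?_⟩, isProperCon_of_mem_con01 h01⟩
    by_cases ha : a = ⊥
    · subst ha
      rw [h01.1 b hab]
    · have hb : b ≠ ⊥ := fun e => ha (h01.1 a (θ.symm (e ▸ hab)))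
      rw [bca a ha, bca b hb]

theorem mk_conBZ :
    #(@conBZ A (toAntiortholattice h).toBZLattice) = #(con01 A ∩ conI A : Set _) + 1 := by
  rw [← properConBZ_eq h, ← mk_insert (a := LatticeCon.full A) (fun hf => hf.2 fun _ _ => trivial)]
  congr 2
  ext θ
  constructor
  · intro hθ
    by_cases hp : IsProperCon θ
    · exact .inr ⟨hθ, hp⟩
    · exact .inl (LatticeCon.ext_r fun a b => ⟨fun _ => trivial, fun _ => not_not.1 hp a b⟩)
  · rintro (rfl | hθ)
    · exact ⟨fun _ _ _ => trivial, fun _ _ _ => trivial⟩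
    · exact hθ.1

end PseudoKleeneAlgebra

open PseudoKleeneAlgebra

/-! ### Adding new bounds -/

namespace NewBounds

section Carrier

variable {A : Type u}

/-- The inclusion of a lattice in the lattice with new bounds. -/
def of (a : A) : WithBot (WithTop A) := ((a : WithTop A) : WithBot (WithTop A))

theorem cases (x : WithBot (WithTop A)) : x = ⊥ ∨ x = ⊤ ∨ ∃ a : A, x = of a := by
  induction x with
  | bot => exact .inl rfl
  | coe x =>
    induction x with
    | top => exact .inr (.inl rfl)
    | coe a => exact .inr (.inr ⟨a, rfl⟩)

theorem of_injective : Function.Injective (of : A → _) := fun _ _ h =>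
  WithTop.coe_injective (WithBot.coe_injective h)

theorem of_ne_bot (a : A) : of a ≠ ⊥ := WithBot.coe_ne_bot

theorem of_ne_top (a : A) : of a ≠ ⊤ := fun h => WithTop.coe_ne_top (WithBot.coe_injective h)

theorem mk_eq (hA : ℵ₀ ≤ #A) : #(WithBot (WithTop A)) = #A := by
  change #(Option (Option A)) = #A
  rw [mk_option, mk_option, add_one_of_aleph0_le hA, add_one_of_aleph0_le hA]

end Carrier

section Lattice

variable {A : Type u} [Lattice A]

theorem of_le_of {a b : A} : of a ≤ of b ↔ a ≤ b :=
  WithBot.coe_le_coe.trans WithTop.coe_le_coe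

theorem of_sup (a b : A) : of (a ⊔ b) = of a ⊔ of b := rfl

theorem of_inf (a b : A) : of (a ⊓ b) = of a ⊓ of b := rfl

theorem monotone_of : Monotone (of : A → _) := fun _ _ => of_le_of.2

theorem mk_ideal_eq (hA : ℵ₀ ≤ #A) : #(Order.Ideal (WithBot (WithTop A))) = #(Order.Ideal A) := by
  have hI := hA.trans (Order.Ideal.mk_type_le A)
  refine le_antisymm ?_ (Order.Ideal.mk_le_of_orderEmbedding (OrderEmbedding.ofMapLEIff of
    fun _ _ => of_le_of))
  have h : #(Option (Option (Order.Ideal A))) = #(Order.Ideal A) := by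
    rw [mk_option, mk_option, add_one_of_aleph0_le hI, add_one_of_aleph0_le hI]
  rw [← h]
  -- The two `none` values account for the improper ideal and the zero ideal; every other ideal is
  -- generated by old elements.
  refine mk_le_of_surjective (f := fun o => o.elim (Order.Ideal.principal ⊤) fun o =>
    o.elim (Order.Ideal.principal ⊥) (Order.Ideal.mapMono of monotone_of)) fun D => ?_
  by_cases hT : ⊤ ∈ D
  · exact ⟨none, le_antisymm (Order.Ideal.principal_le_iff.2 hT) fun x _ => le_top (a := x)⟩
  by_cases ho : ∃ a : A, of a ∈ D
  · obtain ⟨a, ha⟩ := ho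
    obtain ⟨E, hE⟩ := Order.Ideal.exists_mapMono_eq of monotone_of
      (fun a b => (of_sup a b).le) D (fun z hz => by
        rcases cases z with rfl | rfl | ⟨b, rfl⟩
        · exact ⟨a, ha, bot_le⟩
        · exact absurd hz hT
        · exact ⟨b, hz, le_rfl⟩)
    exact ⟨some (some E), hE⟩
  · refine ⟨some none, le_antisymm (Order.Ideal.principal_le_iff.2 D.bot_mem) fun z hz => ?_⟩
    rcases cases z with rfl | rfl | ⟨b, rfl⟩
    · exact le_rfl (a := (⊥ : WithBot (WithTop A)))
    · exact absurd hz hT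
    · exact absurd ⟨b, hz⟩ ho

/-- The extension of a congruence by singleton classes of the new bounds. -/
def extendCon (θ : LatticeCon A) : LatticeCon (WithBot (WithTop A)) where
  r x y := x = y ∨ ∃ a b, x = of a ∧ y = of b ∧ θ.r a b
  iseqv := by
    refine ⟨fun _ => .inl rfl, ?_, ?_⟩
    · rintro x y (rfl | ⟨a, b, rfl, rfl, h⟩)
      · exact .inl rfl
      · exact .inr ⟨b, a, rfl, rfl, θ.symm h⟩
    · rintro x y z (rfl | ⟨a, b, rfl, rfl, h⟩) (rfl | ⟨c, d, hc, rfl, k⟩)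
      · exact .inl rfl
      · exact .inr ⟨c, d, hc, rfl, k⟩
      · exact .inr ⟨a, b, rfl, rfl, h⟩
      · obtain rfl := of_injective hc
        exact .inr ⟨a, d, rfl, rfl, θ.trans h k⟩
  inf := by
    rintro w x y z (rfl | ⟨a, b, rfl, rfl, h⟩) (rfl | ⟨c, d, rfl, rfl, k⟩)
    · exact .inl rfl
    · rcases cases w with rfl | rfl | ⟨e, rfl⟩
      · exact .inl (by simp)
      · exact .inr ⟨c, d, by simp, by simp, k⟩
      · exact .inr ⟨_, _, (of_inf _ _).symm, (of_inf _ _).symm, θ.inf (θ.refl e) k⟩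
    · rcases cases y with rfl | rfl | ⟨e, rfl⟩
      · exact .inl (by simp)
      · exact .inr ⟨a, b, by simp, by simp, h⟩
      · exact .inr ⟨_, _, (of_inf _ _).symm, (of_inf _ _).symm, θ.inf h (θ.refl e)⟩
    · exact .inr ⟨_, _, (of_inf _ _).symm, (of_inf _ _).symm, θ.inf h k⟩
  sup := by
    rintro w x y z (rfl | ⟨a, b, rfl, rfl, h⟩) (rfl | ⟨c, d, rfl, rfl, k⟩)
    · exact .inl rfl
    · rcases cases w with rfl | rfl | ⟨e, rfl⟩
      · exact .inr ⟨c, d, by simp, by simp, k⟩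
      · exact .inl (by simp)
      · exact .inr ⟨_, _, (of_sup _ _).symm, (of_sup _ _).symm, θ.sup (θ.refl e) k⟩
    · rcases cases y with rfl | rfl | ⟨e, rfl⟩
      · exact .inr ⟨a, b, by simp, by simp, h⟩
      · exact .inl (by simp)
      · exact .inr ⟨_, _, (of_sup _ _).symm, (of_sup _ _).symm, θ.sup h (θ.refl e)⟩
    · exact .inr ⟨_, _, (of_sup _ _).symm, (of_sup _ _).symm, θ.sup h k⟩

theorem extendCon_of {θ : LatticeCon A} {a b : A} : (extendCon θ).r (of a) (of b) ↔ θ.r a b := by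
  refine ⟨?_, fun h => .inr ⟨a, b, rfl, rfl, h⟩⟩
  rintro (h | ⟨c, d, hc, hd, h⟩)
  · rw [of_injective h]
  · rwa [of_injective hc, of_injective hd]

theorem extendCon_mem_con01 (θ : LatticeCon A) : extendCon θ ∈ con01 (WithBot (WithTop A)) := by
  constructor
  · rintro x (rfl | ⟨a, b, h, -⟩)
    · rfl
    · exact absurd h.symm (of_ne_bot a)
  · rintro x (rfl | ⟨a, b, h, -⟩)
    · rfl
    · exact absurd h.symm (of_ne_top a)

/-- The restriction of a congruence to the old elements. -/
def restrictCon (ψ : LatticeCon (WithBot (WithTop A))) : LatticeCon A := ψ.comap of of_inf of_sup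

theorem extendCon_restrictCon {ψ : LatticeCon (WithBot (WithTop A))}
    (hψ : ψ ∈ con01 (WithBot (WithTop A))) : extendCon (restrictCon ψ) = ψ := by
  refine LatticeCon.ext_r fun x y => ⟨?_, fun h => ?_⟩
  · rintro (rfl | ⟨a, b, rfl, rfl, h⟩)
    · exact ψ.refl x
    · exact h
  · rcases cases x with rfl | rfl | ⟨a, rfl⟩
    · exact .inl (hψ.1 y h).symm
    · exact .inl (hψ.2 y h).symm
    · rcases cases y with rfl | rfl | ⟨b, rfl⟩
      · exact .inl (hψ.1 _ (ψ.symm h))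
      · exact .inl (hψ.2 _ (ψ.symm h))
      · exact .inr ⟨a, b, rfl, rfl, h⟩

end Lattice

section PseudoKleene

variable {A : Type u} [PseudoKleeneAlgebra A]

/-- The involution on a pseudo-Kleene algebra with new bounds. -/
def involution : WithBot (WithTop A) → WithBot (WithTop A) :=
  WithBot.recBotCoe ⊤ (WithTop.recTopCoe ⊥ fun a => of a′)

instance : PseudoKleeneAlgebra (WithBot (WithTop A)) where
  __ := (inferInstance : Lattice (WithBot (WithTop A)))
  __ := (inferInstance : BoundedOrder (WithBot (WithTop A)))
  kc := involution
  kc_antitone x y h := by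
    rcases cases x with rfl | rfl | ⟨a, rfl⟩
    · exact le_top (α := WithBot (WithTop A))
    · rw [top_le_iff.1 h]
    · rcases cases y with rfl | rfl | ⟨b, rfl⟩
      · exact absurd (le_bot_iff.1 h) (of_ne_bot a)
      · exact bot_le (α := WithBot (WithTop A))
      · exact of_le_of.2 (kc_antitone _ _ (of_le_of.1 h))
  kc_kc x := by
    rcases cases x with rfl | rfl | ⟨a, rfl⟩
    · rfl
    · rfl
    · exact congrArg of (kc_kc a)
  kleene x y := by
    rcases cases x with rfl | rfl | ⟨a, rfl⟩
    · exact inf_le_left.trans bot_le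
    · exact inf_le_right.trans (bot_le (α := WithBot (WithTop A)))
    · rcases cases y with rfl | rfl | ⟨b, rfl⟩
      · exact le_top.trans (le_sup_right (α := WithBot (WithTop A)) (a := ⊥) (b := ⊤))
      · exact le_top.trans le_sup_left
      · exact of_le_of.2 (PseudoKleeneAlgebra.kleene a b)

/-- The meet of two old elements is old, so it is never the new `⊥`. -/
theorem inf_kc_eq_bot (x : WithBot (WithTop A)) (h : x ⊓ x′ = ⊥) : x = ⊥ ∨ x = ⊤ := by
  rcases cases x with rfl | rfl | ⟨a, rfl⟩
  · exact .inl rfl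
  · exact .inr rfl
  · exact absurd h (of_ne_bot (a ⊓ a′))

theorem extendCon_mem_conI {θ : LatticeCon A} :
    extendCon θ ∈ conI (WithBot (WithTop A)) ↔ θ ∈ conI A := by
  constructor
  · exact fun h a b hab => extendCon_of.1 (h _ _ (extendCon_of.2 hab))
  · rintro h x y (rfl | ⟨a, b, rfl, rfl, k⟩)
    · exact .inl rfl
    · exact extendCon_of.2 (h a b k)

/-- Extension by singleton bounds and restriction to `A` are mutually inverse, and both respect the
involution. -/
theorem mk_con01_inter_conI :
    #(con01 (WithBot (WithTop A)) ∩ conI (WithBot (WithTop A)) : Set _) = #(conI A) := by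
  refine (mk_congr (Equiv.ofBijective (fun θ : conI A => (⟨extendCon θ.1, extendCon_mem_con01 θ.1,
    extendCon_mem_conI.2 θ.2⟩ : (con01 (WithBot (WithTop A)) ∩ conI (WithBot (WithTop A)) : Set _)))
    ⟨fun θ ψ h => ?_, fun ψ => ?_⟩)).symm
  · refine Subtype.ext (LatticeCon.ext_r fun a b => ?_)
    have : extendCon θ.1 = extendCon ψ.1 := congrArg Subtype.val h
    rw [← extendCon_of, this, extendCon_of]
  · have h := extendCon_restrictCon ψ.2.1
    exact ⟨⟨restrictCon ψ.1, extendCon_mem_conI.1 (h.symm ▸ ψ.2.2)⟩, Subtype.ext h⟩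

theorem con01_subset_conI (h : conI A = Set.univ) :
    con01 (WithBot (WithTop A)) ⊆ conI (WithBot (WithTop A)) := fun ψ hψ => by
  rw [← extendCon_restrictCon hψ, extendCon_mem_conI, h]
  trivial

end PseudoKleene

end NewBounds

/-! ### A bounded lattice glued below its dual -/

/-- The ordinal sum of a bounded lattice with its dual, with the top of the lattice and the bottom
of its dual identified, as a sublattice of their product. -/
def dualSum (M : Type u) [Lattice M] [BoundedOrder M] : Sublattice (M × Mᵒᵈ) where
  carrier := {p | p.1 = ⊤ ∨ p.2 = ⊥}
  supClosed' := by
    rintro p (hp | hp) q (hq | hq) <;> simp [hp, hq]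
  infClosed' := by
    rintro p (hp | hp) q (hq | hq) <;> simp [hp, hq]

namespace dualSum

variable {M : Type u} [Lattice M] [BoundedOrder M]

instance : BoundedOrder (dualSum M) where
  top := ⟨⊤, .inl rfl⟩
  bot := ⟨⊥, .inr rfl⟩
  le_top _ := Subtype.coe_le_coe.1 le_top
  bot_le _ := Subtype.coe_le_coe.1 bot_le

/-- The inclusion of the lower summand. -/
def lower (x : M) : dualSum M := ⟨(x, ⊥), .inr rfl⟩

/-- The inclusion of the upper summand. -/
def upper (y : Mᵒᵈ) : dualSum M := ⟨(⊤, y), .inl rfl⟩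

theorem lower_le_lower {x y : M} : lower x ≤ lower y ↔ x ≤ y := by
  rw [← Subtype.coe_le_coe]; simp [lower]

theorem upper_le_upper {x y : Mᵒᵈ} : upper x ≤ upper y ↔ x ≤ y := by
  rw [← Subtype.coe_le_coe]; simp [upper]

theorem lower_inf (x y : M) : lower (x ⊓ y) = lower x ⊓ lower y := Subtype.ext (by simp [lower])
theorem lower_sup (x y : M) : lower (x ⊔ y) = lower x ⊔ lower y := Subtype.ext (by simp [lower])
theorem upper_inf (x y : Mᵒᵈ) : upper (x ⊓ y) = upper x ⊓ upper y := Subtype.ext (by simp [upper])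
theorem upper_sup (x y : Mᵒᵈ) : upper (x ⊔ y) = upper x ⊔ upper y := Subtype.ext (by simp [upper])

theorem inf_upper_bot (p : dualSum M) : p ⊓ upper ⊥ = lower p.1.1 :=
  Subtype.ext (by simp [lower, upper, Prod.ext_iff])

theorem sup_upper_bot (p : dualSum M) : p ⊔ upper ⊥ = upper p.1.2 :=
  Subtype.ext (by simp [upper, Prod.ext_iff])

instance : PseudoKleeneAlgebra (dualSum M) where
  kc p := ⟨(p.1.2.ofDual, .toDual p.1.1), p.2.symm⟩
  kc_antitone _ _ h := ⟨h.2, h.1⟩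
  kc_kc _ := rfl
  kleene p q := by
    -- The gluing point `upper ⊥`, fixed by the involution, separates the two sides.
    refine le_trans (b := upper ⊥) ⟨le_top, ?_⟩ ⟨?_, bot_le⟩
    · rcases p.2 with h | h
      · exact inf_le_right.trans (le_of_eq (congrArg OrderDual.toDual h))
      · exact inf_le_left.trans h.le
    · rcases q.2 with h | h
      · exact le_trans (b := q.1.1) h.ge le_sup_left
      · exact le_trans (b := q.1.2.ofDual) (congrArg OrderDual.ofDual h).ge le_sup_right

theorem inf_kc_eq_bot (p : dualSum M) (h : p ⊓ p′ = ⊥) : p = ⊥ ∨ p = ⊤ := by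
  have h1 : p.1.1 ⊓ p.1.2.ofDual = ⊥ := congrArg (fun p : dualSum M => p.1.1) h
  rcases p.2 with k | k
  · refine .inr (Subtype.ext (Prod.ext k ?_))
    rw [k, top_inf_eq] at h1
    exact congrArg OrderDual.toDual h1
  · refine .inl (Subtype.ext (Prod.ext ?_ k))
    rw [k] at h1
    exact (inf_top_eq p.1.1).symm.trans h1

instance [Nontrivial M] : Nontrivial (dualSum M) :=
  ⟨⊥, ⊤, fun h => bot_ne_top (α := M) (congrArg (fun p : dualSum M => p.1.1) h)⟩

/-- By simplicity the restriction to each summand is trivial or full, and full would put the gluing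
point in the class of a bound. An element is determined by its meet and join with the gluing point,
so a congruence trivial on both summands is trivial. -/
theorem con01_eq [Nontrivial M] (hM : LatticeCon.IsSimple M) :
    con01 (dualSum M) = {LatticeCon.eqCon (dualSum M)} := by
  ext θ
  refine ⟨fun hθ => LatticeCon.ext_r fun p q => ?_, ?_⟩
  · have hl : ∀ x y, θ.r (lower x) (lower y) → x = y := by
      rcases hM (θ.comap lower lower_inf lower_sup) with h | h
      · exact h
      · exact absurd (congrArg (fun p : dualSum M => p.1.1) (hθ.1 (lower ⊤) (h ⊥ ⊤))) top_ne_bot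
    have hu : ∀ x y, θ.r (upper x) (upper y) → x = y := by
      rcases hM.dual (θ.comap upper upper_inf upper_sup) with h | h
      · exact h
      · exact absurd (congrArg (fun p : dualSum M => p.1.2) (hθ.2 (upper ⊥) (h ⊤ ⊥)))
          (bot_ne_top (α := Mᵒᵈ))
    refine ⟨fun h => Subtype.ext (Prod.ext (hl _ _ ?_) (hu _ _ ?_)), fun h => ?_⟩
    · rw [← inf_upper_bot, ← inf_upper_bot]
      exact θ.inf h (θ.refl _)
    · rw [← sup_upper_bot, ← sup_upper_bot]
      exact θ.sup h (θ.refl _)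
    · rw [LatticeCon.eqCon_r.1 h]
  · rintro rfl
    exact ⟨fun _ h => (LatticeCon.eqCon_r.1 h).symm, fun _ h => (LatticeCon.eqCon_r.1 h).symm⟩

theorem mk_eq (hM : ℵ₀ ≤ #M) : #(dualSum M) = #M := by
  refine le_antisymm ?_ (mk_le_of_injective (f := lower) fun x y h =>
    congrArg (fun p : dualSum M => p.1.1) h)
  refine (mk_subtype_le _).trans ?_
  rw [mk_prod, lift_id, lift_id]
  exact (mul_eq_self hM).le

/-- An ideal containing the gluing point is generated by its upper part; any other lies in the lower
summand. -/
theorem mk_ideal_eq (hM : ℵ₀ ≤ #M) (h : #(Order.Ideal Mᵒᵈ) = #(Order.Ideal M)) :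
    #(Order.Ideal (dualSum M)) = #(Order.Ideal M) := by
  have ml : Monotone (lower : M → _) := fun _ _ => lower_le_lower.2
  have mu : Monotone (upper : Mᵒᵈ → _) := fun _ _ => upper_le_upper.2
  refine le_antisymm ?_ (Order.Ideal.mk_le_of_orderEmbedding (OrderEmbedding.ofMapLEIff lower
    fun _ _ => lower_le_lower))
  refine le_trans ?_ (add_eq_self (hM.trans (Order.Ideal.mk_type_le M))).le
  nth_rewrite 2 [← h]
  rw [add_def]
  refine mk_le_of_surjective
    (f := Sum.elim (Order.Ideal.mapMono lower ml) (Order.Ideal.mapMono upper mu)) fun D => ?_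
  by_cases hD : upper ⊥ ∈ D
  · obtain ⟨E, hE⟩ := Order.Ideal.exists_mapMono_eq upper mu (fun x y => (upper_sup x y).le) D
      fun p hp => ⟨p.1.2, by rw [← sup_upper_bot]; exact Order.Ideal.sup_mem hp hD,
        by rw [← sup_upper_bot]; exact le_sup_left⟩
    exact ⟨.inr E, hE⟩
  · obtain ⟨E, hE⟩ := Order.Ideal.exists_mapMono_eq lower ml (fun x y => (lower_sup x y).le) D
      fun p hp => by
        have h2 : p = lower p.1.1 := by
          rcases p.2 with k | k
          · exact absurd (D.lower (show upper ⊥ ≤ p from ⟨k.ge, bot_le⟩) hp) hD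
          · exact Subtype.ext (Prod.ext rfl k)
        exact ⟨p.1.1, h2 ▸ hp, h2.le⟩
    exact ⟨.inl E, hE⟩

end dualSum

/-! ### Antiortholattices and the conclusion -/

theorem antiortholatticeRealization {ν : Cardinal.{u}} (hν : ℵ₀ ≤ ν)
    (hsucc : 2 ^ ν = Order.succ ν) : AntiortholatticeRealization ν := by
  intro ι κ hι hι' h2 hκ
  -- New bounds yield one congruence more than a pseudo-Kleene algebra with at least two, so `κ = 2`
  -- is out of their reach.
  obtain rfl | h3 := h2.eq_or_lt
  · obtain ⟨M, _, _, hM, hc, rfl, rfl⟩ := exists_simple_ortholattice hν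
      (hι'.lt_or_eq.imp_left fun h => le_antisymm (Order.lt_succ_iff.1 (hsucc ▸ h)) hι)
    have hcon : con01 (dualSum M) ∩ conI (dualSum M) = {LatticeCon.eqCon (dualSum M)} := by
      rw [dualSum.con01_eq hM, Set.inter_eq_left, Set.singleton_subset_iff]
      rintro a b (rfl : a = b)
      exact rfl
    refine ⟨dualSum M, toAntiortholattice dualSum.inf_kc_eq_bot, dualSum.mk_eq hν,
      dualSum.mk_ideal_eq hν (Order.Ideal.mk_congr (kcIso M)).symm, ?_, fun _ => ?_⟩
    · rw [mk_conBZ, hcon, mk_singleton, one_add_one_eq_two]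
    · rw [properConBZ_eq, hcon, dualSum.con01_eq hM]
  -- One congruence is set aside for the full one, which is not an extension of an old congruence.
  · obtain ⟨κ', hκ', hκ2⟩ : ∃ κ', κ' + 1 = κ ∧ 2 ≤ κ' := by
      rcases lt_or_ge κ ℵ₀ with h | h
      · obtain ⟨n, rfl⟩ := lt_aleph0.1 h
        have hn : 2 < n := by exact_mod_cast h3
        exact ⟨(n - 1 : ℕ), by exact_mod_cast Nat.sub_add_cancel (by omega),
          by exact_mod_cast (by omega : 2 ≤ n - 1)⟩
      · exact ⟨κ, add_one_of_aleph0_le h, h2⟩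
    have hle : κ' ≤ κ := hκ' ▸ le_self_add
    obtain ⟨A, _, rfl, rfl, rfl, hA⟩ :=
      pseudoKleeneRealization hν hsucc ι κ' hι hι' hκ2 (hle.trans hκ)
    refine ⟨WithBot (WithTop A), toAntiortholattice NewBounds.inf_kc_eq_bot, NewBounds.mk_eq hν,
      NewBounds.mk_ideal_eq hν, ?_, fun h => ?_⟩
    · rw [mk_conBZ, NewBounds.mk_con01_inter_conI, hκ']
    · rw [properConBZ_eq, Set.inter_eq_left]
      exact NewBounds.con01_subset_conI (hA (hle.trans_lt h))

theorem corollary4p11 :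
    (GCH.{u} → ∀ ν : Cardinal.{u}, ℵ₀ ≤ ν →
      LatticeRealization ν ∧ PseudoKleeneRealization ν ∧ AntiortholatticeRealization ν) ∧
    (CH.{u} →
      LatticeRealization (ℵ₀ : Cardinal.{u}) ∧ PseudoKleeneRealization (ℵ₀ : Cardinal.{u}) ∧
        AntiortholatticeRealization (ℵ₀ : Cardinal.{u})) := by
  -- Both set-theoretic hypotheses enter only through this equation at the given `ν`, so the
  -- continuum hypothesis suffices at `ℵ₀`.
  have key : ∀ ν : Cardinal.{u}, ℵ₀ ≤ ν → 2 ^ ν = Order.succ ν →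
      LatticeRealization ν ∧ PseudoKleeneRealization ν ∧ AntiortholatticeRealization ν :=
    fun ν hν h => ⟨latticeRealization hν h, pseudoKleeneRealization hν h,
      antiortholatticeRealization hν h⟩
  exact ⟨fun h ν hν => key ν hν (h ν hν), fun h => key ℵ₀ le_rfl (by rw [succ_aleph0]; exact h)⟩
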